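/- **Definitions.** Let $X$ be a metric space. A geodesic ray is a map $c:[0,\infty)\to X$ with $d(c(s),c(t))=|s-t|$ for all $s,t$, and a geodesic line is a map $c:\mathbb{R}\to X$ with the same property. The visual boundary $\partial X$ is the set of geodesic rays modulo the relation $c\sim c'$ if and only if $\sup_{t\ge 0} d(c(t),c'(t))<\infty$. For $\alpha\neq\beta$ in $\partial X$ let $[\alpha,\beta]\subset X$ denote the image of the geodesic line $c$ with $c(-\infty)=\alpha$ and $c(\infty)=\beta$ (in the spaces below it is unique up to reparametrisation). For $o,x,y\in X$ put $(x\mid y)_o=\tfrac12\left(d(x,o)+d(y,o)-d(x,y)\right)$ and for distinct $\alpha,\beta\in\partial X$ put $$(\alpha\mid\beta)_o=\lim_{t\to\infty}(x(t)\mid y(t))_o\quad (x\in\alpha,\ y\in\beta),\qquad d_o(\alpha,\beta)=e^{-(\alpha\mid\beta)_o}.$$ The cross ratio of pairwise distinct $\alpha,\beta,\gamma,\delta\in\partial X$ is $$\omega(\alpha,\beta;\gamma,\delta)=\frac{d_o(\alpha,\gamma)\,d_o(\beta,\delta)}{d_o(\alpha,\delta)\,d_o(\beta,\gamma)},$$ where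 $o\in X$ is any basepoint. Real hyperbolic space $\mathbb{R}\mathrm{H}^n$ is the set of points $[x]$ of the projective space of $\mathbb{R}^{n+1}$ with $\langle x\mid x\rangle<0$, where $\langle x\mid y\rangle=\sum_{k=1}^n x_ky_k-x_{n+1}y_{n+1}$, with the metric given by $\cosh^2 d([x],[y])=\dfrac{\langle x\mid y\rangle\langle y\mid x\rangle}{\langle x\mid x\rangle\langle y\mid y\rangle}$, $d\ge 0$. A tree is the metric realisation (with edges of length one) of a connected acyclic graph all of whose vertices have finite degree at least $3$. **Proposition.** Let $X$ be either a tree or $\mathbb{R}\mathrm{H}^n$ with $n\ge 2$. Then for all distinct $\alpha,\beta\in\partial X$ and all $o\in X$ the limit that defines $(\alpha\mid\beta)_o$ exists and does not depend on the representatives $x\in\alpha$, $y\in\beta$. Moreover, for all pairwise distinct $\alpha,\beta,\gamma,\delta\in\partial X$ and every choice of the basepoint $o\in X$, the lines $[\alpha,\beta]$ and $[\gamma,\delta]$ intersect if and only if $$\omega(\alpha,\gamma;\delta,\beta)\oplus\omega(\alpha,\delta;\gamma,\beta)=1,$$ where $a\oplus b=a+b$ if $X=\mathbb{R}\mathrm{H}^n$,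 and $a\oplus b=\max\{a,b\}$ if $X$ is a tree. -/

import Mathlib

open Filter Topology
open scoped NNReal

noncomputable section

/-! ## Geodesics, the visual boundary and the cross ratio -/

section Boundary

variable (X : Type*) [MetricSpace X]

/-- A geodesic ray `c : [0, ∞) → X`: `dist (c s) (c t) = |s - t|`. -/
structure GeodesicRay where
  toFun : ℝ≥0 → X
  dist_eq : ∀ s t : ℝ≥0, dist (toFun s) (toFun t) = |(s : ℝ) - t|

/-- A geodesic line `c : ℝ → X`: `dist (c s) (c t) = |s - t|`. -/
structure GeodesicLine where
  toFun : ℝ → X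
  dist_eq : ∀ s t : ℝ, dist (toFun s) (toFun t) = |s - t|

variable {X}

instance : CoeFun (GeodesicRay X) (fun _ => ℝ≥0 → X) := ⟨GeodesicRay.toFun⟩

instance : CoeFun (GeodesicLine X) (fun _ => ℝ → X) := ⟨GeodesicLine.toFun⟩

variable (X) in
/-- Two rays are equivalent if they stay at bounded distance from each other. -/
instance GeodesicRay.setoid : Setoid (GeodesicRay X) where
  r c c' := ∃ K > 0, ∀ t, dist (c t) (c' t) < K
  iseqv :=
    { refl := fun c => ⟨1, one_pos, fun t => by simp⟩
      symm := fun ⟨K, hK, h⟩ => ⟨K, hK, fun t => by rw [dist_comm]; exact h t⟩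
      trans := fun ⟨K, hK, h⟩ ⟨L, hL, h'⟩ => ⟨K + L, add_pos hK hL, fun t =>
        (dist_triangle _ _ _).trans_lt (add_lt_add (h t) (h' t))⟩ }

variable (X) in
/-- The visual boundary `∂X`: classes of geodesic rays. -/
def VisualBoundary : Type _ := Quotient (GeodesicRay.setoid X)

/-- The point at infinity `c(∞)` of a geodesic ray. -/
def GeodesicRay.endpoint (c : GeodesicRay X) : VisualBoundary X := Quotient.mk _ c

/-- The ray `t ↦ c t`, `t ≥ 0`, of a geodesic line. -/
def GeodesicLine.forward (c : GeodesicLine X) : GeodesicRay X where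
  toFun t := c t
  dist_eq s t := c.dist_eq s t

/-- The ray `t ↦ c (-t)`, `t ≥ 0`, of a geodesic line. -/
def GeodesicLine.backward (c : GeodesicLine X) : GeodesicRay X where
  toFun t := c (-t)
  dist_eq s t := by rw [c.dist_eq, ← abs_neg]; congr 1; ring

/-- `[α, β]`: the points on the geodesic lines `c` with `c(-∞) = α` and `c(∞) = β`. (In a proper
CAT(-1) space and for `α ≠ β` there is exactly one such line up to translation of the parameter.) -/
def lineBetween (α β : VisualBoundary X) : Set X :=
  {p | ∃ c : GeodesicLine X, c.backward.endpoint = α ∧ c.forward.endpoint = β ∧ ∃ t, c t = p}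

/-- The Gromov product `(x | y)_o`. -/
def gromovProduct (o x y : X) : ℝ := (dist x o + dist y o - dist x y) / 2

/-- The Gromov product `(α | β)_o = lim_{t → ∞} (x(t) | y(t))_o`, where `x ∈ α`, `y ∈ β`. -/
def boundaryGromovProduct (o : X) (α β : VisualBoundary X) : ℝ :=
  limUnder atTop fun t : ℝ≥0 =>
    gromovProduct o ((Quotient.out α : GeodesicRay X) t) ((Quotient.out β : GeodesicRay X) t)

open scoped Classical in
/-- Bourdon's metric `d_o` on `∂X`. -/
def bourdonDist (o : X) (α β : VisualBoundary X) : ℝ :=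
  if α = β then 0 else Real.exp (-boundaryGromovProduct o α β)

/-- The cross ratio `ω(α, β; γ, δ)`, computed with the basepoint `o`. -/
def crossRatio (o : X) (α β γ δ : VisualBoundary X) : ℝ :=
  (bourdonDist o α γ * bourdonDist o β δ) / (bourdonDist o α δ * bourdonDist o β γ)

variable (X) in
/-- For distinct boundary points the limit that defines the Gromov product exists, and it is the
same for all representatives. -/
def GromovProductConverges : Prop :=
  ∀ (o : X) (x y : GeodesicRay X), x.endpoint ≠ y.endpoint →
    Tendsto (fun t : ℝ≥0 => gromovProduct o (x t) (y t)) atTop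
      (𝓝 (boundaryGromovProduct o x.endpoint y.endpoint))

end Boundary

/-! ## Real hyperbolic space -/

/-- The form `⟨x | y⟩ = x₁ y₁ + ⋯ + xₙ yₙ - xₙ₊₁ yₙ₊₁` on `ℝⁿ⁺¹`. -/
def lorentzForm {n : ℕ} (x y : Fin (n + 1) → ℝ) : ℝ :=
  ∑ k : Fin n, x k.castSucc * y k.castSucc - x (Fin.last n) * y (Fin.last n)

namespace lorentzForm

variable {n : ℕ}

lemma symm (x y : Fin (n + 1) → ℝ) : lorentzForm x y = lorentzForm y x := by
  simp only [lorentzForm, mul_comm]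

lemma add_left (x y z : Fin (n + 1) → ℝ) :
    lorentzForm (x + y) z = lorentzForm x z + lorentzForm y z := by
  simp only [lorentzForm, Pi.add_apply, add_mul, Finset.sum_add_distrib]; ring

lemma smul_left (a : ℝ) (x z : Fin (n + 1) → ℝ) :
    lorentzForm (a • x) z = a * lorentzForm x z := by
  simp only [lorentzForm, Pi.smul_apply, smul_eq_mul, mul_assoc, ← Finset.mul_sum]; ring

lemma add_right (x y z : Fin (n + 1) → ℝ) :
    lorentzForm x (y + z) = lorentzForm x y + lorentzForm x z := by
  rw [symm, add_left, symm y, symm z]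

lemma smul_right (a : ℝ) (x z : Fin (n + 1) → ℝ) :
    lorentzForm x (a • z) = a * lorentzForm x z := by
  rw [symm, smul_left, symm z]

/-- The form is positive definite on the orthogonal complement of a negative vector. -/
lemma orthogonal {u y : Fin (n + 1) → ℝ} (hy : lorentzForm y y < 0) (h : lorentzForm u y = 0) :
    0 ≤ lorentzForm u u ∧ (lorentzForm u u = 0 → u = 0) := by
  have cs := Finset.sum_mul_sq_le_sq_mul_sq Finset.univ
    (fun k : Fin n => u k.castSucc) (fun k : Fin n => y k.castSucc)
  simp only [lorentzForm, ← pow_two] at *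
  set U := ∑ k : Fin n, u k.castSucc ^ 2 with hU
  set Y := ∑ k : Fin n, y k.castSucc ^ 2 with hY
  have hU0 : 0 ≤ U := Finset.sum_nonneg fun _ _ => sq_nonneg _
  have hY0 : 0 ≤ Y := Finset.sum_nonneg fun _ _ => sq_nonneg _
  have e : (u (Fin.last n)) ^ 2 * (y (Fin.last n)) ^ 2 ≤ U * Y := by
    rw [← mul_pow, ← sub_eq_zero.mp h]; exact cs
  have hpos : 0 < y (Fin.last n) ^ 2 := by linarith
  refine ⟨?_, fun h0 => ?_⟩
  · have : (u (Fin.last n)) ^ 2 * (y (Fin.last n)) ^ 2 ≤ U * (y (Fin.last n)) ^ 2 :=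
      e.trans (mul_le_mul_of_nonneg_left (by linarith) hU0)
    have := le_of_mul_le_mul_right this hpos
    linarith
  · have hUe : u (Fin.last n) ^ 2 = U := by linarith
    rw [hUe] at e
    have hUz : U = 0 := by
      by_contra hne
      have : 0 < U := lt_of_le_of_ne hU0 (Ne.symm hne)
      have := le_of_mul_le_mul_left e this
      linarith
    have hl : u (Fin.last n) = 0 := by
      rw [hUz] at hUe; exact pow_eq_zero_iff (two_ne_zero) |>.mp hUe
    have hk := (Finset.sum_eq_zero_iff_of_nonneg (fun k _ => sq_nonneg (u (Fin.castSucc k)))).mp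
      (hU ▸ hUz)
    funext i
    refine Fin.lastCases hl (fun k => ?_) i
    exact pow_eq_zero_iff (two_ne_zero) |>.mp (hk k (Finset.mem_univ k))

/-- Subtracting from `x` its component along the unit negative vector `y`. -/
lemma project {x y : Fin (n + 1) → ℝ} (hy : lorentzForm y y = -1) :
    lorentzForm (x + lorentzForm x y • y) y = 0 := by
  rw [add_left, smul_left, hy]; ring

lemma project_self {x y : Fin (n + 1) → ℝ} (hx : lorentzForm x x = -1)
    (hy : lorentzForm y y = -1) :
    lorentzForm (x + lorentzForm x y • y) (x + lorentzForm x y • y) = lorentzForm x y ^ 2 - 1 := by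
  rw [add_left, smul_left, add_right, add_right, smul_right, smul_right, hx, hy, symm y x]; ring

lemma one_le_abs {x y : Fin (n + 1) → ℝ} (hx : lorentzForm x x = -1)
    (hy : lorentzForm y y = -1) : 1 ≤ |lorentzForm x y| := by
  have h := (orthogonal (by rw [hy]; norm_num) (project (x := x) hy)).1
  rw [project_self hx hy] at h
  rw [← one_le_sq_iff_one_le_abs]; linarith

lemma cauchySchwarz {u v y : Fin (n + 1) → ℝ} (hy : lorentzForm y y < 0)
    (hu : lorentzForm u y = 0) (hv : lorentzForm v y = 0) :
    lorentzForm u v ^ 2 ≤ lorentzForm u u * lorentzForm v v := by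
  have := discrim_le_zero (a := lorentzForm u u) (b := 2 * lorentzForm u v)
    (c := lorentzForm v v) fun t => by
      have h : lorentzForm (t • u + v) y = 0 := by rw [add_left, smul_left, hu, hv]; ring
      have := (orthogonal hy h).1
      rw [add_left, smul_left, add_right, add_right, smul_right, smul_right, symm v u] at this
      linarith
  rw [discrim] at this
  nlinarith

lemma triangle {x y z : Fin (n + 1) → ℝ} (hx : lorentzForm x x = -1)
    (hy : lorentzForm y y = -1) (hz : lorentzForm z z = -1) :
    |lorentzForm x z| ≤ |lorentzForm x y| * |lorentzForm y z| +
      √(|lorentzForm x y| ^ 2 - 1) * √(|lorentzForm y z| ^ 2 - 1) := by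
  have cs := cauchySchwarz (by rw [hy]; norm_num) (project (x := x) hy) (project (x := z) hy)
  rw [project_self hx hy, project_self hz hy] at cs
  have e : lorentzForm (x + lorentzForm x y • y) (z + lorentzForm z y • y) =
      lorentzForm x z + lorentzForm x y * lorentzForm z y := by
    rw [add_left, smul_left, add_right, add_right, smul_right, smul_right, hy, symm y z]; ring
  rw [e] at cs
  have hxy := one_le_abs hx hy
  rw [sq_abs, sq_abs, ← Real.sqrt_mul (by rw [← sq_abs]; nlinarith), symm y z]
  have h1 := Real.abs_le_sqrt cs
  have h2 := abs_sub_abs_le_abs_sub (lorentzForm x z) (-(lorentzForm x y * lorentzForm z y))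
  rw [abs_neg, abs_mul, sub_neg_eq_add] at h2
  linarith

end lorentzForm

/-- Real hyperbolic space `ℝHⁿ`: the points `[x]` of the projective space of `ℝⁿ⁺¹` with
`⟨x | x⟩ < 0` (a condition that does not depend on the representative). -/
def RealHyperbolicSpace (n : ℕ) : Type :=
  {p : Projectivization ℝ (Fin (n + 1) → ℝ) // lorentzForm p.rep p.rep < 0}

namespace RealHyperbolicSpace

variable {n : ℕ}

/-- The distance, given by `cosh² d([x], [y]) = ⟨x | y⟩⟨y | x⟩ / (⟨x | x⟩⟨y | y⟩)`
(see `cosh_sq_dist`). -/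
instance : Dist (RealHyperbolicSpace n) where
  dist p q := Real.arcosh √(lorentzForm p.1.rep q.1.rep * lorentzForm q.1.rep p.1.rep /
    (lorentzForm p.1.rep p.1.rep * lorentzForm q.1.rep q.1.rep))

/-- A representative with `⟨x | x⟩ = -1`. -/
def unitRep (p : RealHyperbolicSpace n) : Fin (n + 1) → ℝ :=
  (√(-lorentzForm p.1.rep p.1.rep))⁻¹ • p.1.rep

lemma unitRep_self (p : RealHyperbolicSpace n) : lorentzForm p.unitRep p.unitRep = -1 := by
  have h : 0 < -lorentzForm p.1.rep p.1.rep := neg_pos.mpr p.2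
  have hs := Real.sq_sqrt h.le
  have h0 : √(-lorentzForm p.1.rep p.1.rep) ≠ 0 := (Real.sqrt_pos.mpr h).ne'
  rw [unitRep, lorentzForm.smul_left, lorentzForm.smul_right]
  field_simp
  linarith

lemma dist_eq_arcosh (p q : RealHyperbolicSpace n) :
    dist p q = Real.arcosh |lorentzForm p.unitRep q.unitRep| := by
  have hp : 0 < -lorentzForm p.1.rep p.1.rep := neg_pos.mpr p.2
  have hq : 0 < -lorentzForm q.1.rep q.1.rep := neg_pos.mpr q.2
  change Real.arcosh _ = _
  rw [← Real.sqrt_sq_eq_abs]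
  congr 2
  rw [unitRep, unitRep, lorentzForm.smul_left, lorentzForm.smul_right, mul_pow, mul_pow, inv_pow,
    inv_pow, Real.sq_sqrt hp.le, Real.sq_sqrt hq.le, lorentzForm.symm q.1.rep p.1.rep]
  have := p.2.ne
  have := q.2.ne
  field_simp

lemma cosh_dist (p q : RealHyperbolicSpace n) :
    Real.cosh (dist p q) = |lorentzForm p.unitRep q.unitRep| := by
  rw [dist_eq_arcosh, Real.cosh_arcosh (lorentzForm.one_le_abs p.unitRep_self q.unitRep_self)]

instance : MetricSpace (RealHyperbolicSpace n) where
  dist_self p := by rw [dist_eq_arcosh, unitRep_self]; simp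
  dist_comm p q := by rw [dist_eq_arcosh, dist_eq_arcosh, lorentzForm.symm]
  dist_triangle p q r := by
    have hpq := lorentzForm.one_le_abs p.unitRep_self q.unitRep_self
    have hqr := lorentzForm.one_le_abs q.unitRep_self r.unitRep_self
    have hpr := lorentzForm.one_le_abs p.unitRep_self r.unitRep_self
    have h1 : 0 ≤ dist p q := by rw [dist_eq_arcosh]; exact Real.arcosh_nonneg hpq
    have h2 : 0 ≤ dist q r := by rw [dist_eq_arcosh]; exact Real.arcosh_nonneg hqr
    have h3 : 0 ≤ dist p r := by rw [dist_eq_arcosh]; exact Real.arcosh_nonneg hpr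
    rw [← abs_of_nonneg h3, ← abs_of_nonneg (add_nonneg h1 h2), ← Real.cosh_le_cosh,
      Real.cosh_add, cosh_dist, cosh_dist, cosh_dist, dist_eq_arcosh p q, dist_eq_arcosh q r,
      Real.sinh_arcosh hpq, Real.sinh_arcosh hqr]
    exact lorentzForm.triangle p.unitRep_self q.unitRep_self r.unitRep_self
  eq_of_dist_eq_zero {p q} h := by
    have hpq := lorentzForm.one_le_abs p.unitRep_self q.unitRep_self
    rw [dist_eq_arcosh, Real.arcosh_eq_zero_iff hpq] at h
    have hneg : lorentzForm q.unitRep q.unitRep < 0 := by rw [q.unitRep_self]; norm_num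
    have hz := (lorentzForm.orthogonal hneg
      (lorentzForm.project (x := p.unitRep) q.unitRep_self)).2 (by
        rw [lorentzForm.project_self p.unitRep_self q.unitRep_self, ← sq_abs, h]; norm_num)
    set b := lorentzForm p.unitRep q.unitRep with hb
    have hsp : √(-lorentzForm p.1.rep p.1.rep) ≠ 0 :=
      (Real.sqrt_pos.mpr (neg_pos.mpr p.2)).ne'
    apply Subtype.ext
    rw [← p.1.mk_rep, ← q.1.mk_rep, Projectivization.mk_eq_mk_iff']
    refine ⟨√(-lorentzForm p.1.rep p.1.rep) * (-b * (√(-lorentzForm q.1.rep q.1.rep))⁻¹), ?_⟩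
    have he : p.unitRep = (-b) • q.unitRep := by
      rw [neg_smul]; exact eq_neg_of_add_eq_zero_left hz
    rw [mul_smul, mul_smul, ← unitRep, ← he, unitRep, smul_inv_smul₀ hsp]

/-- The point `[x]` of `ℝHⁿ`, for `⟨x | x⟩ < 0`. -/
def mk (x : Fin (n + 1) → ℝ) (hx : lorentzForm x x < 0) : RealHyperbolicSpace n :=
  ⟨Projectivization.mk ℝ x (by rintro rfl; simp [lorentzForm] at hx), by
    obtain ⟨a, ha⟩ := Projectivization.exists_smul_eq_mk_rep ℝ x
      (by rintro rfl; simp [lorentzForm] at hx)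
    rw [← ha, Units.smul_def, lorentzForm.smul_left, lorentzForm.smul_right]
    have := mul_self_pos.mpr a.ne_zero
    nlinarith⟩

/-- The distance formula, for arbitrary representatives. -/
lemma cosh_sq_dist (x y : Fin (n + 1) → ℝ) (hx : lorentzForm x x < 0) (hy : lorentzForm y y < 0) :
    Real.cosh (dist (mk x hx) (mk y hy)) ^ 2 =
      lorentzForm x y * lorentzForm y x / (lorentzForm x x * lorentzForm y y) := by
  have hx0 : x ≠ 0 := by rintro rfl; simp [lorentzForm] at hx
  have hy0 : y ≠ 0 := by rintro rfl; simp [lorentzForm] at hy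
  obtain ⟨a, ha⟩ := Projectivization.exists_smul_eq_mk_rep ℝ x hx0
  obtain ⟨b, hb⟩ := Projectivization.exists_smul_eq_mk_rep ℝ y hy0
  have ha' : (mk x hx).1.rep = (a : ℝ) • x := ha.symm
  have hb' : (mk y hy).1.rep = (b : ℝ) • y := hb.symm
  have hp : 0 < -lorentzForm (mk x hx).1.rep (mk x hx).1.rep := neg_pos.mpr (mk x hx).2
  have hq : 0 < -lorentzForm (mk y hy).1.rep (mk y hy).1.rep := neg_pos.mpr (mk y hy).2
  rw [cosh_dist, sq_abs, unitRep, unitRep, lorentzForm.smul_left, lorentzForm.smul_right, mul_pow,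
    mul_pow, inv_pow, inv_pow, Real.sq_sqrt hp.le, Real.sq_sqrt hq.le, ha', hb',
    lorentzForm.symm y x]
  simp only [lorentzForm.smul_left, lorentzForm.smul_right]
  have := a.ne_zero
  have := b.ne_zero
  have := hx.ne
  have := hy.ne
  field_simp

end RealHyperbolicSpace

/-! ## The metric realisation of a graph -/

/-- The point `(1 - t) u + t v`, in barycentric coordinates. -/
def edgePoint {V : Type*} (u v : V) (t : ℝ) : V →₀ ℝ :=
  Finsupp.single u (1 - t) + Finsupp.single v t

/-- The underlying set of the metric realisation of a connected graph `G`: the points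
`(1 - t) u + t v`, with `0 ≤ t ≤ 1`, of the edges `uv`, together with the vertices. -/
def MetricRealisation {V : Type*} (G : SimpleGraph V) (_hG : G.Connected) : Type _ :=
  {x : V →₀ ℝ // ∃ u v : V, (u = v ∨ G.Adj u v) ∧ ∃ t ∈ Set.Icc (0 : ℝ) 1, x = edgePoint u v t}

namespace MetricRealisation

variable {V : Type*} {G : SimpleGraph V} {hG : G.Connected}

/-- `r` is the length of the segment from `x` to `y` inside an edge of length one. -/
def EdgeLength (x y : MetricRealisation G hG) (r : ℝ) : Prop :=
  ∃ u v : V, G.Adj u v ∧ ∃ s ∈ Set.Icc (0 : ℝ) 1, ∃ t ∈ Set.Icc (0 : ℝ) 1,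
    x.1 = edgePoint u v s ∧ y.1 = edgePoint u v t ∧ r = |s - t|

/-- `r` is the length of a shortest path that runs from `x` inside its edge to an endpoint `u` of
that edge, then along edges of `G` to an endpoint `v` of the edge of `y`, and then to `y`. -/
def VertexLength (x y : MetricRealisation G hG) (r : ℝ) : Prop :=
  ∃ u ∈ x.1.support, ∃ v ∈ y.1.support, r = (1 - x.1 u) + G.dist u v + (1 - y.1 v)

/-- The path metric for which each edge is isometric to `[0, 1]`. -/
instance : Dist (MetricRealisation G hG) where
  dist x y := sInf {r | EdgeLength x y r ∨ VertexLength x y r}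

lemma edgePoint_apply_left {u v : V} (h : u ≠ v) (t : ℝ) : edgePoint u v t u = 1 - t := by
  simp [edgePoint, h.symm]

lemma edgePoint_apply_right {u v : V} (h : u ≠ v) (t : ℝ) : edgePoint u v t v = t := by
  simp [edgePoint, h]

lemma edgePoint_apply_of_ne {u v w : V} (hu : w ≠ u) (hv : w ≠ v) (t : ℝ) :
    edgePoint u v t w = 0 := by
  simp [edgePoint, hu.symm, hv.symm]

lemma edgePoint_swap (u v : V) (t : ℝ) : edgePoint u v t = edgePoint v u (1 - t) := by
  simp [edgePoint, add_comm]

lemma edgePoint_self (u : V) (t : ℝ) : edgePoint u u t = Finsupp.single u 1 := by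
  simp [edgePoint]

/-- A point is a vertex, or it lies on an edge. -/
lemma cases_point (x : MetricRealisation G hG) : (∃ u, x.1 = Finsupp.single u 1) ∨
    ∃ u v, G.Adj u v ∧ ∃ t ∈ Set.Icc (0 : ℝ) 1, x.1 = edgePoint u v t := by
  obtain ⟨u, v, rfl | h, t, ht, hx⟩ := x.2
  · exact Or.inl ⟨u, by rw [hx, edgePoint_self]⟩
  · exact Or.inr ⟨u, v, h, t, ht, hx⟩

lemma nonneg (x : MetricRealisation G hG) (w : V) : 0 ≤ x.1 w := by
  classical
  rcases cases_point x with ⟨u, hx⟩ | ⟨u, v, h, t, ht, hx⟩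
  · rw [hx, Finsupp.single_apply]; split_ifs <;> norm_num
  · rw [hx]
    by_cases hu : w = u
    · subst hu; rw [edgePoint_apply_left h.ne]; linarith [ht.2]
    by_cases hv : w = v
    · subst hv; rw [edgePoint_apply_right h.ne]; exact ht.1
    rw [edgePoint_apply_of_ne hu hv]

lemma add_le_one (x : MetricRealisation G hG) {w z : V} (hwz : w ≠ z) : x.1 w + x.1 z ≤ 1 := by
  classical
  rcases cases_point x with ⟨u, hx⟩ | ⟨u, v, h, t, ht, hx⟩
  · rw [hx, Finsupp.single_apply, Finsupp.single_apply]
    split_ifs with h1 h2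
    · exact absurd (h1.symm.trans h2) hwz
    all_goals norm_num
  · rw [hx]
    have h0 := ht.1
    have h1 := ht.2
    by_cases hu : w = u
    · subst hu
      rw [edgePoint_apply_left h.ne]
      by_cases hv : z = v
      · subst hv; rw [edgePoint_apply_right h.ne]; linarith
      · rw [edgePoint_apply_of_ne hwz.symm hv]; linarith
    by_cases hv : w = v
    · subst hv
      rw [edgePoint_apply_right h.ne]
      by_cases hu : z = u
      · subst hu; rw [edgePoint_apply_left h.ne]; linarith
      · rw [edgePoint_apply_of_ne hu hwz.symm]; linarith
    rw [edgePoint_apply_of_ne hu hv]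
    by_cases hu : z = u
    · subst hu; rw [edgePoint_apply_left h.ne]; linarith
    by_cases hv : z = v
    · subst hv; rw [edgePoint_apply_right h.ne]; linarith
    rw [edgePoint_apply_of_ne hu hv]; linarith

lemma le_one (x : MetricRealisation G hG) (w : V) : x.1 w ≤ 1 := by
  classical
  rcases cases_point x with ⟨u, hx⟩ | ⟨u, v, h, t, ht, hx⟩
  · rw [hx, Finsupp.single_apply]; split_ifs <;> norm_num
  · by_cases hu : w = u
    · have := add_le_one x (hu ▸ h.ne : w ≠ v)
      linarith [nonneg x v]
    · have := add_le_one x hu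
      linarith [nonneg x u]

lemma exists_mem_support (x : MetricRealisation G hG) : ∃ u, u ∈ x.1.support := by
  rcases cases_point x with ⟨u, hx⟩ | ⟨u, v, h, t, ht, hx⟩
  · exact ⟨u, by simp [hx]⟩
  · by_cases h0 : t = 0
    · exact ⟨u, by rw [hx, Finsupp.mem_support_iff, edgePoint_apply_left h.ne]; simp [h0]⟩
    · exact ⟨v, by rw [hx, Finsupp.mem_support_iff, edgePoint_apply_right h.ne]; exact h0⟩

/-- The vertices that carry `x` are at most `(1 - x v) + (1 - x w)` apart. -/
lemma dist_le_of_mem (x : MetricRealisation G hG) {v w : V} (hv : v ∈ x.1.support)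
    (hw : w ∈ x.1.support) : (G.dist v w : ℝ) ≤ (1 - x.1 v) + (1 - x.1 w) := by
  classical
  by_cases hvw : v = w
  · subst hvw; simp only [SimpleGraph.dist_self, Nat.cast_zero]; linarith [le_one x v]
  have hadj : G.Adj v w := by
    rw [Finsupp.mem_support_iff] at hv hw
    rcases cases_point x with ⟨a, hx⟩ | ⟨a, b, h, t, ht, hx⟩
    · rw [hx, Finsupp.single_apply] at hv hw
      simp only [ne_eq, ite_eq_right_iff, one_ne_zero, imp_false, not_not] at hv hw
      exact absurd (hv.symm.trans hw) hvw
    · rw [hx] at hv hw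
      have hv' : v = a ∨ v = b := by
        by_contra! hc; exact hv (edgePoint_apply_of_ne hc.1 hc.2 t)
      have hw' : w = a ∨ w = b := by
        by_contra! hc; exact hw (edgePoint_apply_of_ne hc.1 hc.2 t)
      rcases hv' with rfl | rfl <;> rcases hw' with rfl | rfl
      · exact absurd rfl hvw
      · exact h
      · exact h.symm
      · exact absurd rfl hvw
  rw [SimpleGraph.dist_eq_one_iff_adj.mpr hadj]
  have := add_le_one x hvw
  push_cast; linarith

lemma EdgeLength.symm {x y : MetricRealisation G hG} {r : ℝ} (h : EdgeLength x y r) :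
    EdgeLength y x r := by
  obtain ⟨u, v, ha, s, hs, t, ht, hx, hy, hr⟩ := h
  exact ⟨u, v, ha, t, ht, s, hs, hy, hx, by rw [hr, abs_sub_comm]⟩

lemma VertexLength.symm {x y : MetricRealisation G hG} {r : ℝ} (h : VertexLength x y r) :
    VertexLength y x r := by
  obtain ⟨u, hu, v, hv, hr⟩ := h
  exact ⟨v, hv, u, hu, by rw [hr, SimpleGraph.dist_comm]; ring⟩

lemma EdgeLength.abs_sub_le {x y : MetricRealisation G hG} {r : ℝ} (h : EdgeLength x y r) (w : V) :
    |x.1 w - y.1 w| ≤ r := by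
  obtain ⟨u, v, ha, s, hs, t, ht, hx, hy, hr⟩ := h
  rw [hx, hy, hr]
  by_cases hu : w = u
  · subst hu
    rw [edgePoint_apply_left ha.ne, edgePoint_apply_left ha.ne, abs_sub_comm]
    apply le_of_eq; congr 1; ring
  by_cases hv : w = v
  · subst hv; rw [edgePoint_apply_right ha.ne, edgePoint_apply_right ha.ne]
  rw [edgePoint_apply_of_ne hu hv, edgePoint_apply_of_ne hu hv]; simp

lemma VertexLength.abs_sub_le {x y : MetricRealisation G hG} {r : ℝ} (h : VertexLength x y r)
    (w : V) : |x.1 w - y.1 w| ≤ r := by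
  obtain ⟨u, hu, v, hv, hr⟩ := h
  have hx0 := nonneg x w
  have hy0 := nonneg y w
  have hx1 := le_one x w
  have hy1 := le_one y w
  have hxu := le_one x u
  have hyv := le_one y v
  by_cases huv : u = v
  · subst huv
    rw [hr, SimpleGraph.dist_self]
    by_cases hw : w = u
    · subst hw; rw [abs_le]; constructor <;> push_cast <;> linarith
    · have := add_le_one x hw
      have := add_le_one y hw
      rw [abs_le]; constructor <;> push_cast <;> linarith
  · have : (1 : ℝ) ≤ G.dist u v := by exact_mod_cast hG.pos_dist_of_ne huv
    rw [hr, abs_le]; constructor <;> linarith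

lemma lengths_nonempty (x y : MetricRealisation G hG) :
    {r | EdgeLength x y r ∨ VertexLength x y r}.Nonempty := by
  obtain ⟨u, hu⟩ := exists_mem_support x
  obtain ⟨v, hv⟩ := exists_mem_support y
  exact ⟨_, Or.inr ⟨u, hu, v, hv, rfl⟩⟩

lemma abs_sub_le_of_length {x y : MetricRealisation G hG} {r : ℝ}
    (h : EdgeLength x y r ∨ VertexLength x y r) (w : V) : |x.1 w - y.1 w| ≤ r :=
  h.elim (fun h => h.abs_sub_le w) (fun h => h.abs_sub_le w)

lemma dist_le_length {x y : MetricRealisation G hG} {r : ℝ}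
    (h : EdgeLength x y r ∨ VertexLength x y r) : dist x y ≤ r := by
  refine csInf_le ⟨0, fun r hr => ?_⟩ h
  obtain ⟨u, _⟩ := exists_mem_support x
  exact (abs_nonneg _).trans (abs_sub_le_of_length hr u)

lemma EdgeLength.exists_vertex {x y : MetricRealisation G hG} {r : ℝ} (h : EdgeLength x y r)
    {v : V} (hv : v ∈ y.1.support) :
    ∃ u ∈ x.1.support, (1 - x.1 u) + G.dist u v ≤ r + (1 - y.1 v) := by
  have hr := abs_le.mp (h.abs_sub_le v)
  by_cases hx : v ∈ x.1.support
  · refine ⟨v, hx, ?_⟩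
    rw [SimpleGraph.dist_self]; push_cast; linarith [hr.1]
  · have hx0 : x.1 v = 0 := by simpa using hx
    obtain ⟨a, b, hab, s, hs, t, ht, hxe, hye, -⟩ := h
    have key : ∀ c d : V, G.Adj c d → ∀ s' : ℝ, x.1 = edgePoint c d s' → d = v →
        ∃ u ∈ x.1.support, (1 - x.1 u) + G.dist u v ≤ r + (1 - y.1 v) := by
      rintro c d hcd s' hxe rfl
      have hs' : s' = 0 := by rw [hxe, edgePoint_apply_right hcd.ne] at hx0; exact hx0
      have hc : x.1 c = 1 := by rw [hxe, edgePoint_apply_left hcd.ne, hs']; ring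
      refine ⟨c, by rw [Finsupp.mem_support_iff, hc]; norm_num, ?_⟩
      rw [hc, SimpleGraph.dist_eq_one_iff_adj.mpr hcd]; push_cast; linarith [hr.1]
    rcases em (v = a) with h1 | h1
    · exact key b a hab.symm (1 - s) (by rw [hxe, edgePoint_swap]) h1.symm
    rcases em (v = b) with h2 | h2
    · exact key a b hab s hxe h2.symm
    · rw [Finsupp.mem_support_iff, hye, edgePoint_apply_of_ne h1 h2] at hv
      exact absurd rfl hv

lemma exists_length_le {x y z : MetricRealisation G hG} {r s : ℝ}
    (h : EdgeLength x y r ∨ VertexLength x y r) (h' : EdgeLength y z s ∨ VertexLength y z s) :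
    ∃ q ≤ r + s, EdgeLength x z q ∨ VertexLength x z q := by
  rcases h with h | ⟨u, hu, v, hv, rfl⟩ <;> rcases h' with h' | ⟨v', hv', w, hw, rfl⟩
  · by_cases hy : ∃ v ∈ y.1.support, y.1 v = 1
    · obtain ⟨v, hv, h1⟩ := hy
      obtain ⟨u, hu, hur⟩ := h.exists_vertex hv
      obtain ⟨w, hw, hws⟩ := h'.symm.exists_vertex hv
      refine ⟨_, ?_, Or.inr ⟨u, hu, w, hw, rfl⟩⟩
      have : (G.dist u w : ℝ) ≤ G.dist u v + G.dist v w := by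
        exact_mod_cast hG.dist_triangle
      rw [SimpleGraph.dist_comm] at hws
      linarith
    · obtain ⟨a, b, hab, p, hp, t, ht, hx, hye, rfl⟩ := h
      obtain ⟨c, d, hcd, t', ht', q, hq, hyf, hz, rfl⟩ := h'
      have ha : y.1 a = 1 - t := by rw [hye, edgePoint_apply_left hab.ne]
      have hb : y.1 b = t := by rw [hye, edgePoint_apply_right hab.ne]
      have ht0 : t ≠ 0 := by
        rintro rfl
        exact hy ⟨a, by rw [Finsupp.mem_support_iff, ha]; norm_num, by rw [ha]; ring⟩
      have ht1 : t ≠ 1 := by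
        rintro rfl
        exact hy ⟨b, by rw [Finsupp.mem_support_iff, hb]; norm_num, hb⟩
      have hmem : ∀ e, y.1 e ≠ 0 → e = c ∨ e = d := by
        intro e he
        by_contra! hc
        rw [hyf, edgePoint_apply_of_ne hc.1 hc.2] at he
        exact he rfl
      have ha' := hmem a (by rw [ha]; intro h0; apply ht1; linarith)
      have hb' := hmem b (by rw [hb]; exact ht0)
      rcases ha' with rfl | rfl <;> rcases hb' with rfl | rfl
      · exact absurd rfl hab.ne
      · have : t' = t := by rw [← hb, hyf, edgePoint_apply_right hab.ne]
        subst this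
        exact ⟨_, abs_sub_le _ _ _, Or.inl ⟨a, b, hab, p, hp, q, hq, hx, hz, rfl⟩⟩
      · have : 1 - t' = t := by rw [← hb, hyf, edgePoint_apply_left hcd.ne]
        refine ⟨|p - (1 - q)|, ?_, Or.inl ⟨a, b, hab, p, hp, 1 - q,
          ⟨by linarith [hq.2], by linarith [hq.1]⟩, hx, by rw [hz, edgePoint_swap], rfl⟩⟩
        have h1 := abs_sub_le p t (1 - q)
        have h2 : |t - (1 - q)| = |t' - q| := by
          rw [← this, abs_sub_comm]; congr 1; ring
        linarith
      · exact absurd rfl hab.ne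
  · obtain ⟨u, hu, hur⟩ := h.exists_vertex hv'
    refine ⟨_, ?_, Or.inr ⟨u, hu, w, hw, rfl⟩⟩
    have : (G.dist u w : ℝ) ≤ G.dist u v' + G.dist v' w := by exact_mod_cast hG.dist_triangle
    linarith
  · obtain ⟨w, hw, hws⟩ := h'.symm.exists_vertex hv
    refine ⟨_, ?_, Or.inr ⟨u, hu, w, hw, rfl⟩⟩
    have : (G.dist u w : ℝ) ≤ G.dist u v + G.dist v w := by exact_mod_cast hG.dist_triangle
    rw [SimpleGraph.dist_comm] at hws
    linarith
  · refine ⟨_, ?_, Or.inr ⟨u, hu, w, hw, rfl⟩⟩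
    have h1 : (G.dist u w : ℝ) ≤ G.dist u v + G.dist v w := by exact_mod_cast hG.dist_triangle
    have h2 : (G.dist v w : ℝ) ≤ G.dist v v' + G.dist v' w := by exact_mod_cast hG.dist_triangle
    have h3 := dist_le_of_mem y hv hv'
    linarith

lemma abs_sub_le_dist (x y : MetricRealisation G hG) (w : V) : |x.1 w - y.1 w| ≤ dist x y :=
  le_csInf (lengths_nonempty x y) fun _ hr => abs_sub_le_of_length hr w

instance : MetricSpace (MetricRealisation G hG) where
  dist_self x := by
    obtain ⟨u, _⟩ := exists_mem_support x
    refine le_antisymm ?_ ((abs_nonneg _).trans (abs_sub_le_dist x x u))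
    rcases cases_point x with ⟨u, hx⟩ | ⟨u, v, h, t, ht, hx⟩
    · exact dist_le_length (Or.inr ⟨u, by simp [hx], u, by simp [hx], by simp [hx]⟩)
    · exact dist_le_length (Or.inl ⟨u, v, h, t, ht, t, ht, hx, hx, by simp⟩)
  dist_comm x y := by
    change sInf _ = sInf _
    congr 1
    ext r
    exact ⟨Or.imp EdgeLength.symm VertexLength.symm, Or.imp EdgeLength.symm VertexLength.symm⟩
  dist_triangle x y z := by
    rw [← sub_le_iff_le_add]
    refine le_csInf (lengths_nonempty x y) fun r hr => ?_
    rw [sub_le_comm]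
    refine le_csInf (lengths_nonempty y z) fun s hs => ?_
    obtain ⟨q, hq, hl⟩ := exists_length_le hr hs
    have := dist_le_length hl
    linarith
  eq_of_dist_eq_zero {x y} h := by
    apply Subtype.ext
    ext w
    have := abs_sub_le_dist x y w
    rw [h] at this
    exact sub_eq_zero.mp (abs_nonpos_iff.mp this)

end MetricRealisation

end

open Filter Topology
open scoped NNReal

noncomputable section

/-! ## Gromov products and cross ratios in terms of rays -/

section Rays

variable {X : Type*} [MetricSpace X]

/-! For rays x, y with distinct endpoints, d(x(t), y(t)) - 2t has a limit D(x, y), and (x | y)_o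
tends to half of the Busemann values of x and y at o minus D(x, y). In a cross ratio the Busemann
values cancel, so it is an exponential in four of the numbers D (`crossRatio_eq_exp`), whatever o
is. In a quadrilateral with diagonals αβ and γδ, the claim then compares the two pairs of opposite
sides with the diagonals.

Trees enter only through the four-point condition and the existence of geodesics. By the four-point
condition the limits D are attained at a finite time, so the question concerns four points a, b, c,
e. If the diagonals have the largest sum, the branch point of a suitable tripod lies on both
(`FourPoint.exists_between`), and `mem_lineBetween_of_between` extends the segments to lines.
Conversely, rays from a common point p have D = 0 along the diagonals and D ≤ 0 along the sides, and
the four-point condition makes one pair of sides sum to 0. The condition holds for vertices because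
every edge of a tree is a bridge; it passes to points of edges one variable at a time.

In the hyperboloid model a ray is exp(t)ξ + exp(-t)η with ξ, η null. The direction of ξ is the
endpoint, D = log(-2⟨ξ | ξ'⟩), and the points of a line are the normalised positive combinations of
the null vectors of its ends. In terms of `nullDist` the claimed equation is equality in Ptolemy's
inequality. A common point gives a + b = c + d for suitably scaled null vectors, and pairing with a,
b, c, d gives that equality. Conversely, equality yields an explicit positive relation ka + lb = rc
+ sd (`exists_smul_add_eq`). -/

lemma VisualBoundary.exists_endpoint_eq (α : VisualBoundary X) :
    ∃ x : GeodesicRay X, x.endpoint = α :=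
  Quotient.exists_rep α

lemma GeodesicRay.endpoint_eq_iff {x y : GeodesicRay X} :
    x.endpoint = y.endpoint ↔ ∃ K > 0, ∀ t, dist (x t) (y t) < K :=
  Quotient.eq

lemma GeodesicRay.endpoint_eq_of_dist_le {x y : GeodesicRay X} {K : ℝ}
    (h : ∀ t, dist (x t) (y t) ≤ K) : x.endpoint = y.endpoint :=
  endpoint_eq_iff.mpr ⟨K + 1, by linarith [dist_nonneg.trans (h 0)], fun t => by linarith [h t]⟩

lemma GeodesicRay.dist_zero (x : GeodesicRay X) (t : ℝ≥0) : dist (x 0) (x t) = t := by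
  rw [x.dist_eq]; simp

lemma GeodesicRay.dist_of_le (x : GeodesicRay X) {s t : ℝ≥0} (h : s ≤ t) :
    dist (x s) (x t) = t - s := by
  rw [x.dist_eq, abs_sub_comm, abs_of_nonneg (sub_nonneg.mpr (NNReal.coe_le_coe.mpr h))]

/-- The Busemann function of a ray exists. -/
lemma GeodesicRay.exists_tendsto_dist_sub (x : GeodesicRay X) (o : X) :
    ∃ b : ℝ, Tendsto (fun t : ℝ≥0 => dist (x t) o - t) atTop (𝓝 b) := by
  -- By the triangle inequality the function is nonincreasing and bounded below by -d(x(0), o).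
  refine ⟨_, tendsto_atTop_ciInf (fun s t h => ?_) ⟨-dist (x 0) o, ?_⟩⟩
  · have h1 := dist_triangle_left (x t) o (x s)
    rw [x.dist_of_le h] at h1
    linarith
  · rintro _ ⟨t, rfl⟩
    have h1 := dist_triangle_right (x 0) (x t) o
    rw [x.dist_zero] at h1
    linarith

lemma bourdonDist_eq_exp (h : GromovProductConverges X) {x y : GeodesicRay X}
    (hxy : x.endpoint ≠ y.endpoint) {o : X} {b c D : ℝ}
    (hb : Tendsto (fun t : ℝ≥0 => dist (x t) o - t) atTop (𝓝 b))
    (hc : Tendsto (fun t : ℝ≥0 => dist (y t) o - t) atTop (𝓝 c))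
    (hD : Tendsto (fun t : ℝ≥0 => dist (x t) (y t) - 2 * t) atTop (𝓝 D)) :
    bourdonDist o x.endpoint y.endpoint = Real.exp ((D - b - c) / 2) := by
  have h1 := h o x y hxy
  have h2 : Tendsto (fun t : ℝ≥0 => gromovProduct o (x t) (y t)) atTop (𝓝 ((b + c - D) / 2)) := by
    refine (((hb.add hc).sub hD).div_const 2).congr fun t => ?_
    rw [gromovProduct]; ring
  rw [bourdonDist, if_neg hxy, tendsto_nhds_unique h1 h2]
  congr 1; ring

/-- Each ray occurs once in the numerator and once in the denominator, so the Busemann values at `o`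
cancel. -/
lemma crossRatio_eq_exp (h : GromovProductConverges X) (o : X) {x y z w : GeodesicRay X}
    (hxz : x.endpoint ≠ z.endpoint) (hyw : y.endpoint ≠ w.endpoint)
    (hxw : x.endpoint ≠ w.endpoint) (hyz : y.endpoint ≠ z.endpoint) {Dxz Dyw Dxw Dyz : ℝ}
    (h1 : Tendsto (fun t : ℝ≥0 => dist (x t) (z t) - 2 * t) atTop (𝓝 Dxz))
    (h2 : Tendsto (fun t : ℝ≥0 => dist (y t) (w t) - 2 * t) atTop (𝓝 Dyw))
    (h3 : Tendsto (fun t : ℝ≥0 => dist (x t) (w t) - 2 * t) atTop (𝓝 Dxw))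
    (h4 : Tendsto (fun t : ℝ≥0 => dist (y t) (z t) - 2 * t) atTop (𝓝 Dyz)) :
    crossRatio o x.endpoint y.endpoint z.endpoint w.endpoint =
      Real.exp ((Dxz + Dyw - Dxw - Dyz) / 2) := by
  obtain ⟨bx, hx⟩ := x.exists_tendsto_dist_sub o
  obtain ⟨byy, hy⟩ := y.exists_tendsto_dist_sub o
  obtain ⟨bz, hz⟩ := z.exists_tendsto_dist_sub o
  obtain ⟨bw, hw⟩ := w.exists_tendsto_dist_sub o
  rw [crossRatio, bourdonDist_eq_exp h hxz hx hz h1, bourdonDist_eq_exp h hyw hy hw h2,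
    bourdonDist_eq_exp h hxw hx hw h3, bourdonDist_eq_exp h hyz hy hz h4,
    ← Real.exp_add, ← Real.exp_add, ← Real.exp_sub]
  congr 1; ring

/-- The ray that leaves `c t₀` in the positive direction of the line `c`. -/
def GeodesicLine.forwardFrom (c : GeodesicLine X) (t₀ : ℝ) : GeodesicRay X where
  toFun t := c (t₀ + t)
  dist_eq s t := by rw [c.dist_eq]; congr 1; ring

/-- The ray that leaves `c t₀` in the negative direction of the line `c`. -/
def GeodesicLine.backwardFrom (c : GeodesicLine X) (t₀ : ℝ) : GeodesicRay X where
  toFun t := c (t₀ - t)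
  dist_eq s t := by rw [c.dist_eq, ← abs_neg]; congr 1; ring

lemma GeodesicLine.endpoint_forwardFrom (c : GeodesicLine X) (t₀ : ℝ) :
    (c.forwardFrom t₀).endpoint = c.forward.endpoint :=
  GeodesicRay.endpoint_eq_of_dist_le (K := |t₀|) fun t => by
    change dist (c (t₀ + t)) (c t) ≤ _
    rw [c.dist_eq, add_sub_cancel_right]

lemma GeodesicLine.endpoint_backwardFrom (c : GeodesicLine X) (t₀ : ℝ) :
    (c.backwardFrom t₀).endpoint = c.backward.endpoint :=
  GeodesicRay.endpoint_eq_of_dist_le (K := |t₀|) fun t => by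
    change dist (c (t₀ - t)) (c (-t)) ≤ _
    rw [c.dist_eq]; apply le_of_eq; congr 1; ring

/-- A point of `[α, β]` is the common origin of opposite rays towards `α` and `β`. -/
lemma exists_rays_of_mem_lineBetween {α β : VisualBoundary X} {p : X} (hp : p ∈ lineBetween α β) :
    ∃ x y : GeodesicRay X, x.endpoint = α ∧ y.endpoint = β ∧ x 0 = p ∧ y 0 = p ∧
      ∀ t : ℝ≥0, dist (x t) (y t) = 2 * t := by
  obtain ⟨c, rfl, rfl, t₀, rfl⟩ := hp
  refine ⟨c.backwardFrom t₀, c.forwardFrom t₀, c.endpoint_backwardFrom t₀,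
    c.endpoint_forwardFrom t₀, ?_, ?_, fun t => ?_⟩
  · change c (t₀ - (0 : ℝ≥0)) = _; simp
  · change c (t₀ + (0 : ℝ≥0)) = _; simp
  · change dist (c (t₀ - t)) (c (t₀ + t)) = _
    rw [c.dist_eq, abs_sub_comm, abs_of_nonneg] <;> ring_nf; positivity

end Rays

/-! ## Metric spaces with the four-point condition -/

/-- The four-point condition (`0`-hyperbolicity). -/
def FourPoint (X : Type*) [MetricSpace X] : Prop :=
  ∀ p q r s : X, dist p q + dist r s ≤ max (dist p r + dist q s) (dist p s + dist q r)

/-- Some `1`-Lipschitz path of length `dist x y` runs from `x` to `y`. -/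
def GeodesicallyJoined {X : Type*} [MetricSpace X] (x y : X) : Prop :=
  ∃ g : ℝ → X, g 0 = x ∧ g (dist x y) = y ∧ ∀ r s, dist (g r) (g s) ≤ |r - s|

section FourPoint

variable {X : Type*} [MetricSpace X]

/-- The strict inequality says that `x s` is not between `x 0` and `p`: the ray has already left the
segment towards `p`, and from then on it moves straight away from `p`. In the four-point condition
it rules out one of the two alternatives. -/
lemma FourPoint.dist_ray (h4 : FourPoint X) (x : GeodesicRay X) (p : X) {s t : ℝ≥0} (hst : s ≤ t)
    (h : dist (x 0) p < dist (x s) p + s) : dist (x t) p = dist (x s) p + (t - s) := by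
  have h1 := h4 (x s) p (x 0) (x t)
  have h2 := dist_triangle_left (x t) p (x s)
  rw [dist_comm (x s) (x 0), x.dist_zero, x.dist_zero, x.dist_of_le hst, dist_comm p (x t),
    dist_comm p (x 0)] at h1
  rw [x.dist_of_le hst] at h2
  rcases le_max_iff.mp h1 with h1 | h1 <;> linarith

/-- The Busemann function is attained at a finite time: a point of the ray farther from `x 0` than
`o` is cannot lie between `x 0` and `o`. -/
lemma FourPoint.exists_dist_ray_eq (h4 : FourPoint X) (x : GeodesicRay X) (o : X) :
    ∃ (b : ℝ) (T : ℝ≥0), ∀ t ≥ T, dist (x t) o = t + b := by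
  set T : ℝ≥0 := ⟨dist (x 0) o + 1, by positivity⟩ with hT
  have hT' : (T : ℝ) = dist (x 0) o + 1 := rfl
  refine ⟨dist (x T) o - T, T, fun t ht => ?_⟩
  rw [h4.dist_ray x o ht]
  · ring
  · have := dist_triangle_right (x 0) (x T) o
    rw [x.dist_zero] at this
    linarith

/-- Rays whose distance falls behind `2t` by arbitrarily large amounts are asymptotic. -/
lemma FourPoint.exists_le_dist (h4 : FourPoint X) {x y : GeodesicRay X}
    (hxy : x.endpoint ≠ y.endpoint) : ∃ M : ℝ, ∀ t : ℝ≥0, 2 * t - M ≤ dist (x t) (y t) := by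
  by_contra! hM
  refine hxy (GeodesicRay.endpoint_eq_of_dist_le (K := dist (x 0) (y 0)) fun t => ?_)
  -- With deficit 2t at time s, the four-point condition bounds the distance of the rays at time t
  -- by that of their origins: first compare `x t` with `y s`, then with `y t`.
  obtain ⟨s, hs⟩ := hM (2 * t)
  have hts : t ≤ s := by
    have := dist_nonneg (x := x s) (y := y s)
    exact NNReal.coe_le_coe.mp (by linarith)
  have h1 := h4 (x t) (y s) (x 0) (x s)
  have h2 := h4 (x t) (y t) (y 0) (y s)
  have h3 := dist_triangle (x 0) (y 0) (y s)
  have h5 := dist_triangle_left (x t) (y 0) (x 0)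
  have ht := t.2
  rw [y.dist_zero] at h3
  rw [x.dist_zero] at h5
  rw [x.dist_zero, x.dist_of_le hts, dist_comm (x t) (x 0), x.dist_zero, dist_comm (y s) (x s),
    dist_comm (y s) (x 0)] at h1
  rw [y.dist_zero, y.dist_of_le hts, dist_comm (y t) (y 0), y.dist_zero] at h2
  have h6 : dist (x t) (y s) ≤ s - t + dist (x 0) (y 0) := by
    have := dist_nonneg (x := x 0) (y := y 0)
    rcases le_max_iff.mp h1 with h1 | h1 <;> linarith
  rcases le_max_iff.mp h2 with h2 | h2 <;> linarith

/-- By the bound `M` on the deficit, after time `T` each ray has left the segment towards the other,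
so `FourPoint.dist_ray` applies in each variable in turn. -/
lemma FourPoint.exists_dist_eq (h4 : FourPoint X) {x y : GeodesicRay X}
    (hxy : x.endpoint ≠ y.endpoint) :
    ∃ (D : ℝ) (T : ℝ≥0), ∀ s ≥ T, ∀ t ≥ T, dist (x s) (y t) = s + t + D := by
  obtain ⟨M, hM⟩ := h4.exists_le_dist hxy
  have hM' : ∀ s t : ℝ≥0, s + t - M ≤ dist (x s) (y t) := by
    intro s t
    rcases le_total s t with h | h
    · have := dist_triangle_left (x t) (y t) (x s)
      rw [x.dist_of_le h] at this
      linarith [hM t]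
    · have := dist_triangle_right (x s) (y s) (y t)
      rw [dist_comm (y s), y.dist_of_le h] at this
      linarith [hM s]
  set T : ℝ≥0 := ⟨dist (x 0) (y 0) + |M| + 1, by positivity⟩ with hT
  have hT' : (T : ℝ) = dist (x 0) (y 0) + |M| + 1 := rfl
  have hM1 := le_abs_self M
  have hT0 := T.2
  refine ⟨dist (x T) (y T) - 2 * T, T, fun s hs t ht => ?_⟩
  rw [h4.dist_ray x (y t) hs, dist_comm, h4.dist_ray y (x T) ht, dist_comm]
  · ring
  · have h1 := dist_triangle_left (y 0) (x T) (x 0)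
    rw [x.dist_zero, dist_comm (x 0)] at h1
    have h2 := hM T
    rw [dist_comm] at h2
    have := abs_nonneg M
    rw [dist_comm (x 0) (y 0)] at hT'
    linarith
  · have h1 := dist_triangle (x 0) (y 0) (y t)
    rw [y.dist_zero] at h1
    have := abs_nonneg M
    linarith [hM' T t]


lemma tendsto_dist_sub_of_dist_eq {x y : GeodesicRay X} {D : ℝ} {T : ℝ≥0}
    (hD : ∀ s ≥ T, ∀ t ≥ T, dist (x s) (y t) = s + t + D) :
    Tendsto (fun t : ℝ≥0 => dist (x t) (y t) - 2 * t) atTop (𝓝 D) := by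
  refine tendsto_const_nhds.congr' ?_
  filter_upwards [eventually_ge_atTop T] with t ht
  rw [hD t ht t ht]; ring

/-- Apply the four-point condition to `x t`, `o`, `x' t`, `y t`. The left side grows like 3t and the
alternative that contains d(x(t), x'(t)) only like t, so the other alternative holds; exchanging `x`
and `x'` gives the reverse inequality. -/
lemma FourPoint.gromovProduct_eventuallyEq (h4 : FourPoint X) (o : X) {x x' y : GeodesicRay X}
    (hx : x.endpoint = x'.endpoint) (hxy : x.endpoint ≠ y.endpoint) :
    (fun t : ℝ≥0 => gromovProduct o (x t) (y t)) =ᶠ[atTop]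
      fun t => gromovProduct o (x' t) (y t) := by
  obtain ⟨K, -, hK⟩ := GeodesicRay.endpoint_eq_iff.mp hx
  obtain ⟨D, T, hD⟩ := h4.exists_dist_eq hxy
  obtain ⟨D', T', hD'⟩ := h4.exists_dist_eq (hx ▸ hxy)
  obtain ⟨b, S, hb⟩ := h4.exists_dist_ray_eq x o
  obtain ⟨b', S', hb'⟩ := h4.exists_dist_ray_eq x' o
  obtain ⟨c, R, hc⟩ := h4.exists_dist_ray_eq y o
  have hlarge : ∀ᶠ t : ℝ≥0 in atTop, K + c - b - D' < t ∧ K + c - b' - D < t :=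
    (NNReal.tendsto_coe_atTop.mpr tendsto_id).eventually_gt_atTop _ |>.and
      ((NNReal.tendsto_coe_atTop.mpr tendsto_id).eventually_gt_atTop _)
  filter_upwards [eventually_ge_atTop T, eventually_ge_atTop T', eventually_ge_atTop S,
    eventually_ge_atTop S', eventually_ge_atTop R, hlarge] with t h1 h2 h3 h5 h6 h7
  have e1 := h4 (x t) o (x' t) (y t)
  have e2 := h4 (x' t) o (x t) (y t)
  rw [dist_comm (x' t) (x t)] at e2
  rw [dist_comm o (x' t), dist_comm o (y t), hc t h6, hb t h3, hb' t h5, hD t h1 t h1,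
    hD' t h2 t h2] at e1
  rw [dist_comm o (x t), dist_comm o (y t), hc t h6, hb t h3, hb' t h5, hD t h1 t h1,
    hD' t h2 t h2] at e2
  rw [gromovProduct, gromovProduct, hb t h3, hb' t h5, hD t h1 t h1, hD' t h2 t h2]
  have hKt := hK t
  have e1' := (le_max_iff.mp e1).resolve_left (by linarith [h7.1])
  have e2' := (le_max_iff.mp e2).resolve_left (by linarith [h7.2])
  linarith

theorem FourPoint.gromovProductConverges (h4 : FourPoint X) : GromovProductConverges X := by
  intro o x y hxy
  obtain ⟨D, T, hD⟩ := h4.exists_dist_eq hxy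
  obtain ⟨b, S, hb⟩ := h4.exists_dist_ray_eq x o
  obtain ⟨c, R, hc⟩ := h4.exists_dist_ray_eq y o
  have key : Tendsto (fun t : ℝ≥0 => gromovProduct o (x t) (y t)) atTop
      (𝓝 ((b + c - D) / 2)) := by
    refine tendsto_const_nhds.congr' ?_
    filter_upwards [eventually_ge_atTop T, eventually_ge_atTop S, eventually_ge_atTop R]
      with t h1 h2 h3
    rw [gromovProduct, hD t h1 t h1, hb t h2, hc t h3]; ring
  have hx : (Quotient.out x.endpoint : GeodesicRay X).endpoint = x.endpoint := Quotient.out_eq _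
  have hy : (Quotient.out y.endpoint : GeodesicRay X).endpoint = y.endpoint := Quotient.out_eq _
  have e1 := h4.gromovProduct_eventuallyEq o hx.symm hxy
  have e2 := h4.gromovProduct_eventuallyEq o hy.symm (hx ▸ hxy.symm)
  have hcomm : ∀ u v : X, gromovProduct o u v = gromovProduct o v u := fun u v => by
    rw [gromovProduct, gromovProduct, dist_comm u v, add_comm (dist u o)]
  have key' : Tendsto (fun t : ℝ≥0 => gromovProduct o ((Quotient.out x.endpoint : GeodesicRay X) t)
      ((Quotient.out y.endpoint : GeodesicRay X) t)) atTop (𝓝 ((b + c - D) / 2)) := by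
    refine key.congr' (e1.trans ?_)
    filter_upwards [e2] with t ht
    rw [hcomm, ht, hcomm]
  rw [boundaryGromovProduct, key'.limUnder_eq]
  exact key

/-! ### Geodesics in `0`-hyperbolic spaces -/

lemma GeodesicallyJoined.symm {x y : X} (h : GeodesicallyJoined x y) : GeodesicallyJoined y x := by
  obtain ⟨g, h0, h1, hg⟩ := h
  refine ⟨fun t => g (dist x y - t), by simpa using h1, by simp [dist_comm y x, h0], fun r s => ?_⟩
  refine (hg _ _).trans (le_of_eq ?_)
  rw [← abs_neg]; congr 1; ring

/-- Being 1-Lipschitz survives gluing at a common value, whereas being isometric need not. Hence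
paths are glued as 1-Lipschitz maps, and exactness of distances is recovered from the endpoints. -/
lemma dist_glue_le {f g : ℝ → X} {a : ℝ} (hf : ∀ r s, dist (f r) (f s) ≤ |r - s|)
    (hg : ∀ r s, dist (g r) (g s) ≤ |r - s|) (h : f a = g a) (r s : ℝ) :
    dist (if r ≤ a then f r else g r) (if s ≤ a then f s else g s) ≤ |r - s| := by
  split_ifs with hr hs hs
  · exact hf r s
  · refine (dist_triangle _ (f a) _).trans ((add_le_add (hf r a) (h ▸ hg a s)).trans ?_)
    rw [abs_of_nonpos (by linarith), abs_of_nonpos (by linarith), abs_of_nonpos (by linarith)]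
    linarith
  · refine (dist_triangle _ (f a) _).trans ((add_le_add (h ▸ hg r a) (hf a s)).trans ?_)
    rw [abs_of_nonneg (by linarith), abs_of_nonneg (by linarith), abs_of_nonneg (by linarith)]
    linarith
  · exact hg r s

lemma GeodesicallyJoined.trans {x y z : X} (h : GeodesicallyJoined x y)
    (h' : GeodesicallyJoined y z) (hd : dist x y + dist y z = dist x z) :
    GeodesicallyJoined x z := by
  obtain ⟨f, f0, f1, hf⟩ := h
  obtain ⟨g, g0, g1, hg⟩ := h'
  refine ⟨fun r => if r ≤ dist x y then f r else g (r - dist x y), ?_, ?_,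
    dist_glue_le hf (fun r s => (hg _ _).trans (le_of_eq ?_)) (by rw [f1, sub_self, g0])⟩
  · simp only [dist_nonneg, if_true, f0]
  · simp only [← hd]
    split_ifs with hle
    -- The endpoint falls into the first branch only if `y = z`.
    · have : dist y z = 0 := le_antisymm (by linarith) dist_nonneg
      rw [this, add_zero, f1, dist_eq_zero.mp this]
    · rw [add_sub_cancel_left, g1]
  · congr 1; ring

/-- A point between `u` and `y` lies on the geodesic from `u` to `y`. -/
lemma FourPoint.joined_of_between (h4 : FourPoint X) {u x y : X} (h : GeodesicallyJoined u y)
    (hd : dist u x + dist x y = dist u y) : GeodesicallyJoined x y := by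
  obtain ⟨g, g0, g1, hg⟩ := h
  have h1 := hg (dist u x) 0
  have h2 := hg (dist u x) (dist u y)
  rw [g0, sub_zero, abs_of_nonneg dist_nonneg] at h1
  rw [g1, abs_of_nonpos (by linarith [dist_nonneg (x := x) (y := y)])] at h2
  -- Both points are between `u` and `y` at the same distance from `u`; the four-point condition
  -- forces them to coincide.
  have hx : g (dist u x) = x := by
    have h5 := h4 (g (dist u x)) x u y
    rw [dist_comm x u] at h5
    refine dist_le_zero.mp ?_
    rcases le_max_iff.mp h5 with h5 | h5 <;> linarith
  refine ⟨fun t => g (dist u x + t), by simpa using hx, by simpa [hd] using g1, fun r s => ?_⟩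
  refine (hg _ _).trans (le_of_eq ?_)
  congr 1; ring

/-- If `[a, b]` and `[c, e]` are the diagonals of four points, then they intersect. -/
lemma FourPoint.exists_between (h4 : FourPoint X) (hX : ∀ x y : X, GeodesicallyJoined x y)
    {a b c e : X} (h1 : dist a c + dist b e ≤ dist a b + dist c e)
    (h2 : dist a e + dist b c ≤ dist a b + dist c e) :
    ∃ p, dist a p + dist p b = dist a b ∧ dist c p + dist p e = dist c e := by
  have key : ∀ {c e : X}, dist a b + dist c e = dist a c + dist b e →
      dist a e + dist b c ≤ dist a b + dist c e →
      ∃ p, dist a p + dist p b = dist a b ∧ dist c p + dist p e = dist c e := by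
    intro c e h1 h2
    obtain ⟨g, g0, g1, hg⟩ := hX a b
    -- `r` is the Gromov product of `b` and `c` at `a`, so `g r` is the branch point of the tripod
    -- `a`, `b`, `c`.
    set r := (dist a b + dist a c - dist b c) / 2 with hr
    have hr0 : 0 ≤ r := by linarith [dist_triangle_left b c a, dist_comm a b, dist_triangle b a c]
    have hr1 : r ≤ dist a b := by linarith [dist_triangle a b c]
    have ha := hg 0 r
    have hb := hg r (dist a b)
    rw [g0, abs_of_nonpos (by linarith)] at ha
    rw [g1, abs_of_nonpos (by linarith)] at hb
    have hc := h4 (g r) c a b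
    have he := h4 (g r) e a b
    rw [dist_comm (g r) a, dist_comm (g r) c, dist_comm c a, dist_comm c b] at hc
    rw [dist_comm (g r) a, dist_comm e a, dist_comm e b] at he
    have hc' : dist c (g r) ≤ (dist a c + dist b c - dist a b) / 2 := by
      rcases le_max_iff.mp hc with hc | hc <;> linarith
    have he' : dist (g r) e ≤ dist b e + r - dist a b := by
      rcases le_max_iff.mp he with he | he <;> linarith
    exact ⟨g r, le_antisymm (by linarith) (dist_triangle _ _ _),
      le_antisymm (by linarith) (dist_triangle _ _ _)⟩
  -- One pair of sides has the same sum as the diagonals; the second case is the first with `c` and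
  -- `e` exchanged.
  rcases le_max_iff.mp (h4 a b c e) with h | h
  · exact key (le_antisymm h h1) h2
  · obtain ⟨p, hp, hp'⟩ := key (c := e) (e := c) (by rw [dist_comm e c]; linarith)
      (by rw [dist_comm e c]; linarith)
    exact ⟨p, hp, by rw [add_comm, dist_comm c p, dist_comm p e, hp', dist_comm]⟩

/-- Two rays and a broken geodesic through `p` between their origins form a geodesic line. -/
lemma mem_lineBetween_of_between (hX : ∀ x y : X, GeodesicallyJoined x y) {x y : GeodesicRay X}
    {D : ℝ} {T : ℝ≥0} (hD : ∀ s ≥ T, ∀ t ≥ T, dist (x s) (y t) = s + t + D) {p : X}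
    (hp : dist (x T) p + dist p (y T) = dist (x T) (y T)) :
    p ∈ lineBetween x.endpoint y.endpoint := by
  obtain ⟨g, g0, g1, hg⟩ := hX p (y T)
  obtain ⟨f, f0, f1, hf⟩ := hX p (x T)
  set a := dist p (x T) with ha
  set b := dist p (y T) with hb
  have ha0 : 0 ≤ a := dist_nonneg
  have hb0 : 0 ≤ b := dist_nonneg
  have hray : ∀ (z : GeodesicRay X) (r s : ℝ), dist (z r.toNNReal) (z s.toNNReal) ≤ |r - s| := by
    intro z r s
    rw [z.dist_eq, Real.coe_toNNReal', Real.coe_toNNReal']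
    exact abs_max_sub_max_le_abs r s 0
  let x' : ℝ → X := fun r => x (T - r - a).toNNReal
  let y' : ℝ → X := fun r => y (T + r - b).toNNReal
  have hx' : ∀ r s, dist (x' r) (x' s) ≤ |r - s| := fun r s => (hray x _ _).trans (le_of_eq (by
    rw [← abs_neg]; congr 1; ring))
  have hy' : ∀ r s, dist (y' r) (y' s) ≤ |r - s| := fun r s => (hray y _ _).trans (le_of_eq (by
    congr 1; ring))
  -- The line is parametrised with `p` at time 0: `x` reversed, the path from `x T` to `p`, the path
  -- from `p` to `y T`, then `y`.
  let L : ℝ → X := fun r => if r ≤ 0 then (if r ≤ -a then x' r else f (-r)) else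
    (if r ≤ b then g r else y' r)
  have hL : ∀ r s, dist (L r) (L s) ≤ |r - s| := by
    refine dist_glue_le (dist_glue_le hx' (fun r s => (hf _ _).trans (le_of_eq ?_)) ?_)
      (dist_glue_le hg hy' ?_) ?_
    · rw [← abs_neg]; congr 1; ring
    · simp only [x', neg_neg, f1]; simp
    · simp only [y', g1]; simp
    · rw [if_pos hb0, g0]
      split_ifs with h0
      · have h0' : a = 0 := by linarith
        have : p = x T := dist_eq_zero.mp h0'
        simp only [x', h0', sub_zero, Real.toNNReal_coe, this]
      · rw [neg_zero, f0]
  have hneg : ∀ r, r ≤ -a → L r = x' r := fun r hr => by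
    simp only [L]; rw [if_pos (by linarith), if_pos hr]
  have hpos : ∀ r, b < r → L r = y' r := fun r hr => by
    simp only [L]; rw [if_neg (by linarith), if_neg (by linarith)]
  have hab : a + b = 2 * T + D := by
    rw [ha, dist_comm p (x T), hp, hD T le_rfl T le_rfl]; ring
  have hends : ∀ r, a < r → b < r → dist (L (-r)) (L r) = 2 * r := fun r h1 h2 => by
    have e1 : T ≤ (T - -r - a : ℝ).toNNReal := by
      refine NNReal.coe_le_coe.mp ?_
      rw [Real.coe_toNNReal _ (by linarith [T.2])]; linarith
    have e2 : T ≤ (T + r - b : ℝ).toNNReal := by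
      refine NNReal.coe_le_coe.mp ?_
      rw [Real.coe_toNNReal _ (by linarith [T.2])]; linarith
    rw [hneg _ (by linarith), hpos _ h2, hD _ e1 _ e2, Real.coe_toNNReal _ (by linarith [T.2]),
      Real.coe_toNNReal _ (by linarith [T.2])]
    linarith
  -- A 1-Lipschitz path whose far ends are exactly as far apart as their parameters cannot lose
  -- length anywhere in between.
  have hle : ∀ r s, r ≤ s → dist (L r) (L s) = |r - s| := fun r s hrs => by
    refine le_antisymm (hL r s) ?_
    set R := a + b + 1 + |r| + |s|
    have hr0 := neg_abs_le r
    have hs0 := le_abs_self s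
    have := abs_nonneg r
    have := abs_nonneg s
    have h1 := hends R (by linarith) (by linarith)
    have h2 := dist_triangle4 (L (-R)) (L r) (L s) (L R)
    have h3 := hL (-R) r
    have h4 := hL s R
    rw [abs_of_nonpos (by linarith)] at h3 h4 ⊢
    linarith
  let c : GeodesicLine X := ⟨L, fun r s => by
    rcases le_total r s with h | h
    · exact hle r s h
    · rw [dist_comm, abs_sub_comm]; exact hle s r h⟩
  have hT := T.2
  refine ⟨c, GeodesicRay.endpoint_eq_of_dist_le (K := a + T) fun t => ?_,
    GeodesicRay.endpoint_eq_of_dist_le (K := b + T + 2) fun t => ?_, 0, ?_⟩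
  · change dist (L (-t)) (x t) ≤ _
    have h1 := hL (-t) (-t - a)
    have h2 := x.dist_of_le (le_add_self : t ≤ T + t)
    have h3 : L (-t - a) = x (T + t) := by
      rw [hneg _ (by linarith [t.2])]
      simp only [x']
      congr 1
      rw [show (T - (-t - a) - a : ℝ) = (T + t : ℝ≥0) by push_cast; ring, Real.toNNReal_coe]
    rw [abs_of_nonneg (by linarith), h3] at h1
    rw [dist_comm] at h2
    refine (dist_triangle _ _ _).trans ((add_le_add h1 h2.le).trans (le_of_eq ?_))
    push_cast; ring
  · change dist (L t) (y t) ≤ _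
    -- The extra 1 moves strictly past the breakpoint `b`, where `hpos` applies; it accounts for the
    -- 2 in the bound.
    have h1 := hL t (t + b + 1)
    have h2 := y.dist_of_le (show t ≤ T + t + 1 from le_add_right le_add_self)
    have h3 : L (t + b + 1) = y (T + t + 1) := by
      rw [hpos _ (by linarith [t.2])]
      simp only [y']
      congr 1
      rw [show (T + (t + b + 1) - b : ℝ) = (T + t + 1 : ℝ≥0) by push_cast; ring,
        Real.toNNReal_coe]
    rw [abs_of_nonpos (by linarith), h3] at h1
    rw [dist_comm] at h2
    refine (dist_triangle _ _ _).trans ((add_le_add h1 h2.le).trans (le_of_eq ?_))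
    push_cast; ring
  · change L 0 = p
    simp only [L, le_refl, if_true, neg_zero, f0]
    split_ifs with h0
    · have h0' : a = 0 := by linarith
      simp only [x', h0', sub_zero, Real.toNNReal_coe]
      exact (dist_eq_zero.mp h0').symm
    · rfl

/-- In a `0`-hyperbolic geodesic space, `[α, β]` and `[γ, δ]` intersect if and only if the larger
one of the two cross ratios is `1`. -/
theorem FourPoint.inter_nonempty_iff (h4 : FourPoint X) (hX : ∀ x y : X, GeodesicallyJoined x y)
    {α β γ δ : VisualBoundary X} (hαβ : α ≠ β) (hαγ : α ≠ γ) (hαδ : α ≠ δ) (hβγ : β ≠ γ)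
    (hβδ : β ≠ δ) (hγδ : γ ≠ δ) (o : X) :
    (lineBetween α β ∩ lineBetween γ δ).Nonempty ↔
      max (crossRatio o α γ δ β) (crossRatio o α δ γ β) = 1 := by
  have hconv := h4.gromovProductConverges
  constructor
  · rintro ⟨p, hp, hp'⟩
    obtain ⟨a, b, rfl, rfl, ha, hb, hab⟩ := exists_rays_of_mem_lineBetween hp
    obtain ⟨c, e, rfl, rfl, hc, he, hce⟩ := exists_rays_of_mem_lineBetween hp'
    obtain ⟨Dac, T₁, h1⟩ := h4.exists_dist_eq hαγ
    obtain ⟨Dae, T₂, h2⟩ := h4.exists_dist_eq hαδ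
    obtain ⟨Dbc, T₃, h3⟩ := h4.exists_dist_eq hβγ
    obtain ⟨Dbe, T₄, h5⟩ := h4.exists_dist_eq hβδ
    have hDab : Tendsto (fun t : ℝ≥0 => dist (a t) (b t) - 2 * t) atTop (𝓝 0) := by
      simp [hab]
    have hDce : Tendsto (fun t : ℝ≥0 => dist (c t) (e t) - 2 * t) atTop (𝓝 0) := by
      simp [hce]
    have hswap : ∀ {x y : GeodesicRay X} {D : ℝ},
        Tendsto (fun t : ℝ≥0 => dist (x t) (y t) - 2 * t) atTop (𝓝 D) →
        Tendsto (fun t : ℝ≥0 => dist (y t) (x t) - 2 * t) atTop (𝓝 D) := by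
      intro x y D h; simpa only [dist_comm] using h
    rw [crossRatio_eq_exp hconv o hαδ hβγ.symm hαβ hγδ (tendsto_dist_sub_of_dist_eq h2)
      (hswap (tendsto_dist_sub_of_dist_eq h3)) hDab hDce,
      crossRatio_eq_exp hconv o hαγ hβδ.symm hαβ hγδ.symm (tendsto_dist_sub_of_dist_eq h1)
      (hswap (tendsto_dist_sub_of_dist_eq h5)) hDab (hswap hDce)]
    obtain ⟨t, ht₁, ht₂, ht₃, ht₄⟩ : ∃ t, T₁ ≤ t ∧ T₂ ≤ t ∧ T₃ ≤ t ∧ T₄ ≤ t :=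
      ⟨T₁ ⊔ T₂ ⊔ T₃ ⊔ T₄, by simp, by simp, by simp, by simp⟩
    -- Paths through `p` show that the four limits along the sides are at most 0; the four-point
    -- condition makes one of the two pair sums at least 0.
    have hq := h4 (a t) (b t) (c t) (e t)
    have hle : ∀ x y : GeodesicRay X, x 0 = p → y 0 = p → dist (x t) (y t) ≤ 2 * t := by
      intro x y hx hy
      have := dist_triangle_left (x t) (y t) p
      nth_rewrite 1 [← hx] at this
      rw [← hy, x.dist_zero, y.dist_zero] at this
      linarith
    have l1 := hle a c ha hc
    have l2 := hle a e ha he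
    have l3 := hle b c hb hc
    have l4 := hle b e hb he
    rw [h1 t ht₁ t ht₁] at l1
    rw [h2 t ht₂ t ht₂] at l2
    rw [h3 t ht₃ t ht₃] at l3
    rw [h5 t ht₄ t ht₄] at l4
    rw [hab, hce, h1 t ht₁ t ht₁, h2 t ht₂ t ht₂, h3 t ht₃ t ht₃, h5 t ht₄ t ht₄] at hq
    apply le_antisymm
    · rw [max_le_iff, Real.exp_le_one_iff, Real.exp_le_one_iff]
      constructor <;> linarith
    · rw [le_max_iff, Real.one_le_exp_iff, Real.one_le_exp_iff]
      rcases le_max_iff.mp hq with h | h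
      · right; linarith
      · left; linarith
  · obtain ⟨a, rfl⟩ := α.exists_endpoint_eq
    obtain ⟨b, rfl⟩ := β.exists_endpoint_eq
    obtain ⟨c, rfl⟩ := γ.exists_endpoint_eq
    obtain ⟨e, rfl⟩ := δ.exists_endpoint_eq
    obtain ⟨Dab, T₁, hab⟩ := h4.exists_dist_eq hαβ
    obtain ⟨Dac, T₂, hac⟩ := h4.exists_dist_eq hαγ
    obtain ⟨Dae, T₃, hae⟩ := h4.exists_dist_eq hαδ
    obtain ⟨Dcb, T₄, hcb⟩ := h4.exists_dist_eq hβγ.symm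
    obtain ⟨Deb, T₅, heb⟩ := h4.exists_dist_eq hβδ.symm
    obtain ⟨Dce, T₆, hce⟩ := h4.exists_dist_eq hγδ
    have hec : Tendsto (fun t : ℝ≥0 => dist (e t) (c t) - 2 * t) atTop (𝓝 Dce) := by
      simpa only [dist_comm] using tendsto_dist_sub_of_dist_eq hce
    rw [crossRatio_eq_exp hconv o hαδ hβγ.symm hαβ hγδ (tendsto_dist_sub_of_dist_eq hae)
      (tendsto_dist_sub_of_dist_eq hcb) (tendsto_dist_sub_of_dist_eq hab)
      (tendsto_dist_sub_of_dist_eq hce),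
      crossRatio_eq_exp hconv o hαγ hβδ.symm hαβ hγδ.symm (tendsto_dist_sub_of_dist_eq hac)
      (tendsto_dist_sub_of_dist_eq heb) (tendsto_dist_sub_of_dist_eq hab) hec]
    intro hmax
    -- Only the inequality `≤ 1` is needed.
    have hmax' := max_le_iff.mp hmax.le
    rw [Real.exp_le_one_iff, Real.exp_le_one_iff] at hmax'
    obtain ⟨t, ht₁, ht₂, ht₃, ht₄, ht₅, ht₆⟩ :
        ∃ t, T₁ ≤ t ∧ T₂ ≤ t ∧ T₃ ≤ t ∧ T₄ ≤ t ∧ T₅ ≤ t ∧ T₆ ≤ t :=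
      ⟨T₁ ⊔ T₂ ⊔ T₃ ⊔ T₄ ⊔ T₅ ⊔ T₆, by simp, by simp, by simp, by simp, by simp, by simp⟩
    obtain ⟨p, hp, hp'⟩ := h4.exists_between hX (a := a t) (b := b t) (c := c t) (e := e t)
      (by rw [dist_comm (b t), hac t ht₂ t ht₂, heb t ht₅ t ht₅, hab t ht₁ t ht₁,
            hce t ht₆ t ht₆]; linarith)
      (by rw [dist_comm (b t), hae t ht₃ t ht₃, hcb t ht₄ t ht₄, hab t ht₁ t ht₁,
            hce t ht₆ t ht₆]; linarith)
    exact ⟨p, mem_lineBetween_of_between hX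
      (fun r hr s hs => hab r (ht₁.trans hr) s (ht₁.trans hs)) hp,
      mem_lineBetween_of_between hX
      (fun r hr s hs => hce r (ht₆.trans hr) s (ht₆.trans hs)) hp'⟩

end FourPoint

/-! ## Trees -/

namespace SimpleGraph.IsTree

variable {V : Type*} {G : SimpleGraph V}

/-- The edge `uv` is the only one between its two sides. -/
lemma eq_of_adj_of_dist (hG : G.IsTree) {u v a b : V} (huv : G.Adj u v) (hab : G.Adj a b)
    (ha : G.dist v a = G.dist u a + 1) (hb : G.dist u b = G.dist v b + 1) : a = u ∧ b = v := by
  classical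
  obtain ⟨P, hP⟩ := hG.connected.exists_walk_length_eq_dist u a
  obtain ⟨Q, hQ⟩ := hG.connected.exists_walk_length_eq_dist b v
  -- The walk from `u` to `a`, across `ab`, and on to `v` must use the bridge `uv`. The geodesics
  -- `P` and `Q` stay on their own sides, so `ab` is that edge.
  have hbr := isBridge_iff_forall_walk_mem_edges.mp
    (isAcyclic_iff_forall_adj_isBridge.mp hG.isAcyclic huv) (P.append (Walk.cons hab Q))
  rw [Walk.edges_append, Walk.edges_cons, List.mem_append, List.mem_cons] at hbr
  rcases hbr with h | h | h
  · have h1 := Walk.snd_mem_support_of_mem_edges P h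
    have h2 := dist_le (P.dropUntil v h1)
    have h3 := P.length_dropUntil_le_length h1
    omega
  · rcases Sym2.eq_iff.mp h with ⟨rfl, rfl⟩ | ⟨rfl, rfl⟩
    · exact ⟨rfl, rfl⟩
    · simp at ha
  · have h1 := Walk.fst_mem_support_of_mem_edges Q h
    have h2 := dist_le (Q.takeUntil u h1)
    have h3 := Q.length_takeUntil_le_length h1
    rw [dist_comm] at h2 hQ
    omega

/-- A geodesic between points on the two sides of the edge `uv` crosses that edge. -/
lemma dist_eq_of_sides (hG : G.IsTree) {u v r q : V} (huv : G.Adj u v)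
    (hr : G.dist v r = G.dist u r + 1) (hq : G.dist u q = G.dist v q + 1) :
    G.dist r q = G.dist u r + 1 + G.dist v q := by
  have key : ∀ {r q : V} (W : G.Walk r q), G.dist v r = G.dist u r + 1 →
      G.dist u q = G.dist v q + 1 → G.dist u r + 1 + G.dist v q ≤ W.length := by
    intro r q W
    -- The walk starts on the side of `u` and ends on that of `v`; the step that changes sides is
    -- `uv` itself.
    induction W with
    | nil => intro h1 h2; omega
    | @cons r r' q h W ih =>
      intro h1 h2
      have h3 := hG.dist_eq_dist_add_one_of_adj r' huv
      rw [Walk.length_cons]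
      rcases h3 with h3 | h3
      · obtain ⟨rfl, rfl⟩ := hG.eq_of_adj_of_dist huv h h1
          (by rw [dist_comm, h3, dist_comm])
        have := dist_le W
        simp only [dist_self]
        omega
      · have := ih (by rw [dist_comm, h3, dist_comm]) h2
        have h4 := hG.connected.dist_triangle (u := u) (v := r') (w := r)
        rw [dist_eq_one_iff_adj.mpr h.symm] at h4
        omega
  obtain ⟨W, hW⟩ := hG.connected.exists_walk_length_eq_dist r q
  refine le_antisymm ?_ (hW ▸ key W hr hq)
  have h1 := hG.connected.dist_triangle (u := r) (v := u) (w := q)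
  rw [dist_comm (u := r) (v := u)] at h1
  omega

lemma dist_eq_or (hG : G.IsTree) {u v : V} (huv : G.Adj u v) (w : V) :
    G.dist u w = G.dist v w + 1 ∨ G.dist v w = G.dist u w + 1 := by
  simpa only [dist_comm] using hG.dist_eq_dist_add_one_of_adj w huv

/-- The vertices of a tree satisfy the four-point condition. -/
lemma fourPoint (hG : G.IsTree) (p q r s : V) : G.dist p q + G.dist r s ≤
    max (G.dist p r + G.dist q s) (G.dist p s + G.dist q r) := by
  obtain ⟨W, -⟩ := hG.connected.exists_walk_length_eq_dist p q
  have tri := fun a b c => hG.connected.dist_triangle (u := a) (v := b) (w := c)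
  induction W with
  | @nil p =>
    have := tri r p s
    rw [dist_comm (u := r) (v := p)] at this
    rw [dist_self, zero_add]
    exact le_max_of_le_left this
  | @cons p p' q h W ih =>
    -- Each of `q`, `r`, `s` is on one side of the edge `p p'`, and this side fixes how its distance
    -- changes from `p` to `p'`. Points on opposite sides have their distance computed across the
    -- edge.
    have cross := fun a b => hG.dist_eq_of_sides (r := a) (q := b) h
    have c1 := cross q r
    have c2 := cross r q
    have c3 := cross q s
    have c4 := cross s q
    have c5 := cross r s
    have c6 := cross s r
    have t1 := tri r p s
    have t2 := tri r p' s
    rw [dist_comm (u := r) (v := q)] at c2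
    rw [dist_comm (u := s) (v := q)] at c4
    rw [dist_comm (u := s) (v := r)] at c6
    rw [dist_comm (u := r) (v := p)] at t1
    rw [dist_comm (u := r) (v := p')] at t2
    rcases hG.dist_eq_or h q with hq | hq <;> rcases hG.dist_eq_or h r with hr | hr <;>
      rcases hG.dist_eq_or h s with hs | hs <;> simp only [hq, hr, hs, forall_const] at * <;> omega

end SimpleGraph.IsTree

/-! ### The metric realisation of a tree is 0-hyperbolic and geodesic -/

namespace MetricRealisation

variable {V : Type*} {G : SimpleGraph V} {hG : G.Connected}

/-- A vertex of the graph as a point of the metric realisation. -/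
def vertex (u : V) : MetricRealisation G hG :=
  ⟨Finsupp.single u 1, u, u, Or.inl rfl, 0, by simp, (edgePoint_self u 0).symm⟩

lemma vertex_apply_self (u : V) : (vertex u : MetricRealisation G hG).1 u = 1 := by
  simp [vertex]

lemma mem_support_vertex (u : V) : u ∈ (vertex u : MetricRealisation G hG).1.support := by
  simp [vertex]

lemma dist_vertex_le {u w : V} {y : MetricRealisation G hG} (hw : w ∈ y.1.support) :
    dist (vertex u) y ≤ G.dist u w + (1 - y.1 w) := by
  refine (dist_le_length (Or.inr ⟨u, mem_support_vertex u, w, hw, rfl⟩)).trans (le_of_eq ?_)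
  rw [vertex_apply_self]; ring

/-- A length inside an edge that starts at a vertex is also bounded below by some vertex length
(`EdgeLength.exists_vertex`), so the infimum is controlled by a minimum over the finite support. -/
lemma exists_dist_vertex_ge (u : V) (y : MetricRealisation G hG) :
    ∃ w ∈ y.1.support, G.dist u w + (1 - y.1 w) ≤ dist (vertex u) y := by
  obtain ⟨w, hw, hmin⟩ := y.1.support.exists_min_image (fun w => (G.dist u w : ℝ) + (1 - y.1 w))
    (exists_mem_support y)
  refine ⟨w, hw, le_csInf (lengths_nonempty _ _) ?_⟩
  rintro r (h | ⟨u', hu', v, hv, rfl⟩)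
  · obtain ⟨v, hv, hr⟩ := h.symm.exists_vertex (mem_support_vertex u)
    rw [vertex_apply_self, SimpleGraph.dist_comm] at hr
    linarith [hmin v hv]
  · have hu : u' = u := by simpa [vertex] using hu'
    rw [hu, vertex_apply_self]
    linarith [hmin v hv]

lemma dist_vertex_vertex (u v : V) :
    dist (vertex u : MetricRealisation G hG) (vertex v) = G.dist u v := by
  refine le_antisymm ?_ ?_
  · simpa [vertex_apply_self] using dist_vertex_le (u := u) (hG := hG) (mem_support_vertex v)
  · obtain ⟨w, hw, h⟩ := exists_dist_vertex_ge (hG := hG) u (vertex v)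
    have hwv : w = v := by simpa [vertex] using hw
    simpa [hwv, vertex_apply_self] using h

lemma dist_edgePoint_le {x y : MetricRealisation G hG} {u v : V} (huv : G.Adj u v) {s t : ℝ}
    (hs : s ∈ Set.Icc (0 : ℝ) 1) (ht : t ∈ Set.Icc (0 : ℝ) 1) (hx : x.1 = edgePoint u v s)
    (hy : y.1 = edgePoint u v t) : dist x y ≤ |s - t| :=
  dist_le_length (Or.inl ⟨u, v, huv, s, hs, t, ht, hx, hy, rfl⟩)

lemma dist_left_le {x : MetricRealisation G hG} {u v : V} (huv : G.Adj u v) {t : ℝ}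
    (ht : t ∈ Set.Icc (0 : ℝ) 1) (hx : x.1 = edgePoint u v t) : dist (vertex u) x ≤ t := by
  refine (dist_edgePoint_le huv (by simp) ht ?_ hx).trans_eq (?_ : |0 - t| = t)
  · simp [vertex, edgePoint]
  · rw [zero_sub, abs_neg, abs_of_nonneg ht.1]

lemma dist_right_le {x : MetricRealisation G hG} {u v : V} (huv : G.Adj u v) {t : ℝ}
    (ht : t ∈ Set.Icc (0 : ℝ) 1) (hx : x.1 = edgePoint u v t) : dist (vertex v) x ≤ 1 - t :=
  dist_left_le huv.symm ⟨by linarith [ht.2], by linarith [ht.1]⟩ (by rw [hx, edgePoint_swap])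

lemma exists_edgePoint_of_mem_support {y : MetricRealisation G hG} {u v : V} (huv : u ≠ v)
    (hu : u ∈ y.1.support) (hv : v ∈ y.1.support) :
    G.Adj u v ∧ ∃ s ∈ Set.Icc (0 : ℝ) 1, y.1 = edgePoint u v s := by
  classical
  rw [Finsupp.mem_support_iff] at hu hv
  rcases cases_point y with ⟨a, hy⟩ | ⟨a, b, hab, s, hs, hy⟩
  · have h : ∀ w, y.1 w ≠ 0 → w = a := by
      intro w hw
      by_contra hne
      exact hw (by rw [hy, Finsupp.single_eq_of_ne hne])
    exact absurd ((h u hu).trans (h v hv).symm) huv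
  · have h : ∀ w, y.1 w ≠ 0 → w = a ∨ w = b := by
      intro w hw
      by_contra! hne
      exact hw (by rw [hy, edgePoint_apply_of_ne hne.1 hne.2])
    rcases h u hu with rfl | rfl <;> rcases h v hv with rfl | rfl
    · exact absurd rfl huv
    · exact ⟨hab, s, hs, hy⟩
    · exact ⟨hab.symm, 1 - s, ⟨by linarith [hs.2], by linarith [hs.1]⟩, by rw [hy, edgePoint_swap]⟩
    · exact absurd rfl huv

/-- In a tree, a point of the edge `uv` lies between `u` and `y` or between `v` and `y`. -/
lemma dist_le_sub_or (hT : G.IsTree) {x : MetricRealisation G hG} (y : MetricRealisation G hG)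
    {u v : V} (huv : G.Adj u v) {t : ℝ} (ht : t ∈ Set.Icc (0 : ℝ) 1) (hx : x.1 = edgePoint u v t) :
    dist x y ≤ dist (vertex u) y - t ∨ dist x y ≤ dist (vertex v) y - (1 - t) := by
  obtain ⟨w, hw, h1⟩ := exists_dist_vertex_ge u y
  obtain ⟨w', hw', h2⟩ := exists_dist_vertex_ge v y
  have hl := dist_left_le huv ht hx
  have hr := dist_right_le huv ht hx
  rcases hT.dist_eq_or huv w with h | h
  · left
    have h3 := dist_triangle_left x y (vertex v)
    have h4 := dist_vertex_le (u := v) hw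
    have h5 : (G.dist u w : ℝ) = G.dist v w + 1 := by exact_mod_cast h
    linarith
  rcases hT.dist_eq_or huv w' with h' | h'
  -- Here the carriers `w` and `w'` of `y` lie on different sides of `uv`, so they are `u` and `v`,
  -- and `y` lies on the same edge as `x`.
  · have hne : w ≠ w' := by rintro rfl; omega
    obtain ⟨hadj, s, hs, hy⟩ := exists_edgePoint_of_mem_support hne hw hw'
    obtain ⟨rfl, rfl⟩ := hT.eq_of_adj_of_dist huv hadj h h'
    rw [hy, SimpleGraph.dist_self, edgePoint_apply_left huv.ne] at h1
    rw [hy, SimpleGraph.dist_self, edgePoint_apply_right huv.ne] at h2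
    have h3 := dist_edgePoint_le huv ht hs hx hy
    push_cast at h1 h2
    rcases abs_cases (t - s) with ⟨h5, -⟩ | ⟨h5, -⟩
    · right; linarith
    · left; linarith
  · right
    have h3 := dist_triangle_left x y (vertex u)
    have h4 := dist_vertex_le (u := u) hw'
    have h5 : (G.dist v w' : ℝ) = G.dist u w' + 1 := by exact_mod_cast h'
    linarith

/-- The four-point inequality in the first variable holds for all points if it holds for
vertices. -/
lemma fourPoint_of_vertex (hT : G.IsTree) {q r s : MetricRealisation G hG}
    (h : ∀ u : V, dist (vertex u) q + dist r s ≤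
      max (dist (vertex u) r + dist q s) (dist (vertex u) s + dist q r))
    (p : MetricRealisation G hG) :
    dist p q + dist r s ≤ max (dist p r + dist q s) (dist p s + dist q r) := by
  rcases cases_point p with ⟨u, hp⟩ | ⟨u, v, huv, t, ht, hp⟩
  · rw [show p = vertex u from Subtype.ext hp]; exact h u
  · have hl := dist_left_le huv ht hp
    have hr := dist_right_le huv ht hp
    -- Take the end `w` of the edge for which `p` is between `w` and `q`. Replacing `p` by `w`
    -- increases the left side by at least `c` and each term on the right by at most `c`.
    have key : ∀ (w : V) (c : ℝ), dist (vertex w) p ≤ c → dist p q ≤ dist (vertex w) q - c →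
        dist p q + dist r s ≤ max (dist p r + dist q s) (dist p s + dist q r) := by
      intro w c h1 h2
      have h3 := dist_triangle (vertex w) p r
      have h4 := dist_triangle (vertex w) p s
      rcases le_max_iff.mp (h w) with h5 | h5
      · exact le_max_of_le_left (by linarith)
      · exact le_max_of_le_right (by linarith)
    rcases dist_le_sub_or hT q huv ht hp with h1 | h1
    · exact key u t hl h1
    · exact key v (1 - t) hr h1

theorem fourPoint (hT : G.IsTree) : FourPoint (MetricRealisation G hG) := by
  intro p q r s
  refine fourPoint_of_vertex hT (fun a => ?_) p
  have hq := fourPoint_of_vertex hT (q := vertex a) (r := r) (s := s) (fun b => ?_) q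
  · simpa only [dist_comm, add_comm, max_comm] using hq
  have hr := fourPoint_of_vertex hT (q := s) (r := vertex a) (s := vertex b) (fun c => ?_) r
  · simpa only [dist_comm, add_comm, max_comm] using hr
  have hs := fourPoint_of_vertex hT (q := vertex c) (r := vertex a) (s := vertex b) (fun d => ?_) s
  · simpa only [dist_comm, add_comm, max_comm] using hs
  simp only [dist_vertex_vertex]
  exact_mod_cast hT.fourPoint d c a b

lemma joined_of_adj {u v : V} (huv : G.Adj u v) :
    GeodesicallyJoined (vertex u : MetricRealisation G hG) (vertex v) := by
  -- Clamping the parameter to [0, 1] is 1-Lipschitz and defines the path on all of ℝ.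
  have hI : ∀ t : ℝ, max 0 (min 1 t) ∈ Set.Icc (0 : ℝ) 1 := fun t =>
    ⟨le_max_left _ _, max_le zero_le_one (min_le_left _ _)⟩
  refine ⟨fun t => ⟨edgePoint u v (max 0 (min 1 t)), u, v, Or.inr huv, _, hI t, rfl⟩, ?_, ?_,
    fun r s => (dist_edgePoint_le huv (hI r) (hI s) rfl rfl).trans ?_⟩
  · apply Subtype.ext; simp [vertex, edgePoint]
  · apply Subtype.ext
    rw [dist_vertex_vertex, SimpleGraph.dist_eq_one_iff_adj.mpr huv]
    simp [vertex, edgePoint]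
  · rw [max_comm 0, max_comm 0, min_comm 1, min_comm 1]
    exact (abs_max_sub_max_le_abs _ _ _).trans (abs_min_sub_min_le_max _ _ _ _ |>.trans (by simp))

lemma joined_vertex_vertex (u v : V) :
    GeodesicallyJoined (vertex u : MetricRealisation G hG) (vertex v) := by
  obtain ⟨W, hW⟩ := hG.exists_walk_length_eq_dist u v
  induction W with
  | @nil u => exact ⟨fun _ => vertex u, rfl, rfl, fun r s => by simp⟩
  | @cons u w v h W ih =>
    have h1 := SimpleGraph.dist_le W
    have h2 := hG.dist_triangle (u := u) (v := w) (w := v)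
    have h3 := SimpleGraph.dist_eq_one_iff_adj.mpr h
    rw [SimpleGraph.Walk.length_cons] at hW
    refine (joined_of_adj h).trans (ih (by omega)) ?_
    simp only [dist_vertex_vertex]
    exact_mod_cast (show _ = _ by omega)

/-- Shortest walks join vertices. A point of an edge lies between one end of that edge and `y`, so a
piece of the path from that end joins it to `y`; symmetry then frees the other endpoint. -/
theorem joined (hT : G.IsTree) (x y : MetricRealisation G hG) : GeodesicallyJoined x y := by
  have key : ∀ y : MetricRealisation G hG, (∀ u, GeodesicallyJoined (vertex u) y) →
      ∀ x, GeodesicallyJoined x y := by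
    intro y h x
    rcases cases_point x with ⟨u, hx⟩ | ⟨u, v, huv, t, ht, hx⟩
    · rw [show x = vertex u from Subtype.ext hx]; exact h u
    · have hl := dist_left_le huv ht hx
      have hr := dist_right_le huv ht hx
      rcases dist_le_sub_or hT y huv ht hx with h1 | h1
      · exact (fourPoint hT).joined_of_between (h u)
          (le_antisymm (by linarith) (dist_triangle _ _ _))
      · exact (fourPoint hT).joined_of_between (h v)
          (le_antisymm (by linarith) (dist_triangle _ _ _))
  exact key y (fun u => (key (vertex u) (fun v => joined_vertex_vertex v u) y).symm) x

end MetricRealisation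

/-! ## Geodesics of real hyperbolic space -/

namespace lorentzForm

variable {n : ℕ}

lemma sub_left (x y z : Fin (n + 1) → ℝ) :
    lorentzForm (x - y) z = lorentzForm x z - lorentzForm y z := by
  simp only [lorentzForm, Pi.sub_apply, sub_mul, Finset.sum_sub_distrib]; ring

lemma sub_right (x y z : Fin (n + 1) → ℝ) :
    lorentzForm x (y - z) = lorentzForm x y - lorentzForm x z := by
  rw [symm, sub_left, symm y, symm z]

/-- Two future-pointing causal vectors have nonpositive product. -/
lemma nonpos_of_causal {x y : Fin (n + 1) → ℝ} (hx : lorentzForm x x ≤ 0)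
    (hy : lorentzForm y y ≤ 0) (hx0 : 0 ≤ x (Fin.last n)) (hy0 : 0 ≤ y (Fin.last n)) :
    lorentzForm x y ≤ 0 := by
  have cs := Finset.sum_mul_sq_le_sq_mul_sq Finset.univ
    (fun k : Fin n => x k.castSucc) (fun k : Fin n => y k.castSucc)
  simp only [lorentzForm, ← pow_two] at *
  rw [sub_nonpos] at hx hy ⊢
  refine abs_le_of_sq_le_sq' (cs.trans ?_) (mul_nonneg hx0 hy0) |>.2
  rw [mul_pow]
  exact mul_le_mul hx hy (Finset.sum_nonneg fun _ _ => sq_nonneg _) (sq_nonneg _)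

lemma last_ne_zero {x : Fin (n + 1) → ℝ} (hx : lorentzForm x x < 0) : x (Fin.last n) ≠ 0 := by
  intro h0
  rw [lorentzForm, h0, mul_zero, sub_zero] at hx
  exact absurd hx (not_lt.mpr (Finset.sum_nonneg fun _ _ => mul_self_nonneg _))

/-- Null coordinates for the plane spanned by two unit vectors at distance one. -/
lemma exists_null_frame {u w : Fin (n + 1) → ℝ} (hu : lorentzForm u u = -1)
    (hw : lorentzForm w w = -1) (huw : lorentzForm u w = -Real.cosh 1) :
    ∃ ξ η : Fin (n + 1) → ℝ, lorentzForm ξ ξ = 0 ∧ lorentzForm η η = 0 ∧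
      lorentzForm ξ η = -1 / 2 ∧ ∀ (x : Fin (n + 1) → ℝ) (t : ℝ), lorentzForm x x = -1 →
        lorentzForm x u = -Real.cosh t → lorentzForm x w = -Real.cosh (t - 1) →
        x = Real.exp t • ξ + Real.exp (-t) • η := by
  set E := Real.exp 1 with hE
  set e := Real.exp (-1) with he
  have hEe : E * e = 1 := by rw [hE, he, ← Real.exp_add]; simp
  have hlt : e < E := Real.exp_lt_exp.mpr (by norm_num)
  set k := (E - e)⁻¹ with hk
  have hkE : k * (E - e) = 1 := inv_mul_cancel₀ (by linarith)
  have hc : Real.cosh 1 = (E + e) / 2 := Real.cosh_eq 1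
  rw [hc] at huw
  -- `ξ` and `η` solve u = ξ + η and w = Eξ + eη, the values at times 0 and 1 of the curve exp(t)ξ +
  -- exp(-t)η.
  set ξ := k • (w - e • u) with hξ
  set η := k • (E • u - w) with hη
  have huw' : lorentzForm w u = -((E + e) / 2) := by rw [symm, huw]
  have h1 : lorentzForm ξ ξ = 0 := by
    simp only [hξ, smul_left, smul_right, sub_left, sub_right, hu, hw, huw, huw']
    linear_combination k ^ 2 * hEe
  have h2 : lorentzForm η η = 0 := by
    simp only [hη, smul_left, smul_right, sub_left, sub_right, hu, hw, huw, huw']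
    linear_combination k ^ 2 * hEe
  have h3 : lorentzForm ξ η = -1 / 2 := by
    simp only [hξ, hη, smul_left, smul_right, sub_left, sub_right, hu, hw, huw, huw']
    linear_combination (-1/2 : ℝ) * (k * (E - e) + 1) * hkE - k ^ 2 * hEe
  have h3' : lorentzForm η ξ = -1 / 2 := by rw [symm, h3]
  refine ⟨ξ, η, h1, h2, h3, fun x t hx hxu hxw => ?_⟩
  set S := Real.exp t with hS
  set s := Real.exp (-t) with hs
  have hSs : S * s = 1 := by rw [hS, hs, ← Real.exp_add]; simp
  have ht : Real.cosh t = (S + s) / 2 := Real.cosh_eq t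
  have ht1 : Real.cosh (t - 1) = (S * e + s * E) / 2 := by
    rw [Real.cosh_eq, hS, he, hs, hE, ← Real.exp_add, ← Real.exp_add]
    congr 3; ring
  rw [ht] at hxu
  rw [ht1] at hxw
  have h4 : lorentzForm x ξ = -s / 2 := by
    simp only [hξ, smul_right, sub_right, hxu, hxw]
    linear_combination (-s / 2) * hkE
  have h5 : lorentzForm x η = -S / 2 := by
    simp only [hη, smul_right, sub_right, hxu, hxw]
    linear_combination (-S / 2) * hkE
  have h6 : lorentzForm ξ u = -1 / 2 := by
    simp only [hξ, smul_left, sub_left, hu, huw']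
    linear_combination (-1 / 2) * hkE
  have h7 : lorentzForm η u = -1 / 2 := by
    simp only [hη, smul_left, sub_left, hu, huw']
    linear_combination (-1 / 2) * hkE
  -- The difference is null and orthogonal to the negative vector `u`, hence zero.
  refine sub_eq_zero.mp ((orthogonal (u := x - (S • ξ + s • η)) (y := u) (by rw [hu]; norm_num)
    ?_).2 ?_)
  · simp only [sub_left, add_left, smul_left, hxu, h6, h7]; ring
  · have h4' : lorentzForm ξ x = -s / 2 := by rw [symm, h4]
    have h5' : lorentzForm η x = -S / 2 := by rw [symm, h5]
    simp only [sub_left, sub_right, add_left, add_right, smul_left, smul_right, hx, h1, h2, h3,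
      h3', h4, h5, h4', h5']
    linear_combination hSs

/-- Null vectors that are orthogonal to each other are parallel. -/
lemma eq_smul_of_null {ξ η u : Fin (n + 1) → ℝ} (hu : lorentzForm u u < 0)
    (hξ : lorentzForm ξ ξ = 0) (hη : lorentzForm η η = 0) (h : lorentzForm ξ η = 0)
    (hξu : lorentzForm ξ u < 0) (hηu : lorentzForm η u < 0) : ∃ k > (0 : ℝ), η = k • ξ := by
  -- This factor makes η - kξ orthogonal to `u`; being null as well, that vector vanishes.
  refine ⟨lorentzForm η u / lorentzForm ξ u, div_pos_of_neg_of_neg hηu hξu, ?_⟩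
  refine sub_eq_zero.mp ((orthogonal hu ?_).2 ?_)
  · rw [sub_left, smul_left, div_mul_cancel₀ _ hξu.ne, sub_self]
  · rw [sub_left, sub_right, sub_right, smul_left, smul_left, smul_right, smul_right, hη, hξ,
      symm η ξ, h]; ring

end lorentzForm

/-! ### The future sheet, and boundary points as null directions -/

namespace RealHyperbolicSpace

variable {n : ℕ}

open lorentzForm

/-- The representative on the future sheet of the hyperboloid. -/
def futureRep (p : RealHyperbolicSpace n) : Fin (n + 1) → ℝ :=
  if 0 < p.unitRep (Fin.last n) then p.unitRep else (-1 : ℝ) • p.unitRep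

lemma futureRep_self (p : RealHyperbolicSpace n) : lorentzForm p.futureRep p.futureRep = -1 := by
  rw [futureRep]
  split_ifs
  · exact p.unitRep_self
  · rw [smul_left, smul_right, p.unitRep_self]; norm_num

lemma futureRep_last_pos (p : RealHyperbolicSpace n) : 0 < p.futureRep (Fin.last n) := by
  rw [futureRep]
  split_ifs with h
  · exact h
  · have h1 := last_ne_zero (x := p.unitRep) (by rw [p.unitRep_self]; norm_num)
    have h2 := lt_of_le_of_ne (not_lt.mp h) h1
    simpa using h2

/-- On the future sheet the form is nonpositive, which removes the absolute value from `cosh_dist`.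
-/
lemma lorentzForm_futureRep (p q : RealHyperbolicSpace n) :
    lorentzForm p.futureRep q.futureRep = -Real.cosh (dist p q) := by
  have h := nonpos_of_causal (by rw [futureRep_self]; norm_num) (by rw [futureRep_self]; norm_num)
    p.futureRep_last_pos.le q.futureRep_last_pos.le
  rw [cosh_dist, eq_neg_iff_add_eq_zero, add_comm, ← eq_neg_iff_add_eq_zero, ← abs_of_nonpos h]
  rw [futureRep, futureRep]
  split_ifs <;> simp only [smul_left, smul_right, abs_mul, abs_neg, abs_one, one_mul]

lemma dist_eq_arcosh_futureRep (p q : RealHyperbolicSpace n) :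
    dist p q = Real.arcosh (-lorentzForm p.futureRep q.futureRep) := by
  rw [lorentzForm_futureRep, neg_neg, Real.arcosh_cosh dist_nonneg]

lemma exists_futureRep_eq {z : Fin (n + 1) → ℝ} (hz : lorentzForm z z = -1)
    (hz0 : 0 ≤ z (Fin.last n)) : ∃ p : RealHyperbolicSpace n, p.futureRep = z := by
  have hneg : lorentzForm z z < 0 := by rw [hz]; norm_num
  have hpos : 0 < z (Fin.last n) := lt_of_le_of_ne hz0 (last_ne_zero hneg).symm
  have hz' : z ≠ 0 := by rintro rfl; simp at hpos
  obtain ⟨a, ha⟩ := Projectivization.exists_smul_eq_mk_rep ℝ z hz'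
  have ha' : (mk z hneg).1.rep = (a : ℝ) • z := ha.symm
  have ha0 : (a : ℝ) ≠ 0 := a.ne_zero
  have hu : (mk z hneg).unitRep = (|(a : ℝ)|⁻¹ * a) • z := by
    rw [unitRep, ha', smul_left, smul_right, hz, smul_smul,
      show -((a : ℝ) * (a * -1)) = (a : ℝ) ^ 2 by ring, Real.sqrt_sq_eq_abs]
  refine ⟨mk z hneg, ?_⟩
  rw [futureRep, hu]
  rcases lt_or_gt_of_ne ha0 with h | h
  · have : |(a : ℝ)|⁻¹ * a = -1 := by rw [abs_of_neg h]; field_simp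
    rw [this, if_neg (by simpa using hpos.le), smul_smul]; simp
  · have : |(a : ℝ)|⁻¹ * a = 1 := by rw [abs_of_pos h]; field_simp
    rw [this, one_smul, if_pos hpos]

/-- Null vectors `ξ`, `η` such that `exp t • ξ + exp (-t) • η` represents `x t`. -/
structure IsNullFrame (x : GeodesicRay (RealHyperbolicSpace n)) (ξ η : Fin (n + 1) → ℝ) :
    Prop where
  null_left : lorentzForm ξ ξ = 0
  null_right : lorentzForm η η = 0
  form_eq : lorentzForm ξ η = -1 / 2
  futureRep_eq : ∀ t : ℝ≥0, (x t).futureRep = Real.exp t • ξ + Real.exp (-t) • η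

lemma exists_isNullFrame (x : GeodesicRay (RealHyperbolicSpace n)) :
    ∃ ξ η, IsNullFrame x ξ η := by
  have hd : ∀ s t : ℝ≥0, lorentzForm (x s).futureRep (x t).futureRep = -Real.cosh (s - t) :=
    fun s t => by rw [lorentzForm_futureRep, x.dist_eq, Real.cosh_abs]
  obtain ⟨ξ, η, h1, h2, h3, h⟩ := exists_null_frame (x 0).futureRep_self (x 1).futureRep_self
    (by rw [hd]; simp)
  exact ⟨ξ, η, h1, h2, h3, fun t => h _ t (x t).futureRep_self (by rw [hd]; simp) (by rw [hd]; simp)⟩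

/-- Opposite rays on a line have opposite frames. -/
lemma exists_isNullFrame_of_mem_lineBetween {α β : VisualBoundary (RealHyperbolicSpace n)}
    {p : RealHyperbolicSpace n} (hp : p ∈ lineBetween α β) :
    ∃ x y ξ η, x.endpoint = α ∧ y.endpoint = β ∧ IsNullFrame x ξ η ∧ IsNullFrame y η ξ ∧
      p.futureRep = ξ + η := by
  obtain ⟨c, rfl, rfl, t₀, rfl⟩ := hp
  have hd : ∀ s t : ℝ, lorentzForm (c s).futureRep (c t).futureRep = -Real.cosh (s - t) :=
    fun s t => by rw [lorentzForm_futureRep, c.dist_eq, Real.cosh_abs]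
  obtain ⟨η, ξ, h1, h2, h3, h⟩ := exists_null_frame (c t₀).futureRep_self
    (c (t₀ + 1)).futureRep_self (by rw [hd]; simp)
  have hc : ∀ t, (c (t₀ + t)).futureRep = Real.exp t • η + Real.exp (-t) • ξ := fun t =>
    h _ t (c _).futureRep_self (by rw [hd]; congr 2; ring) (by rw [hd]; congr 2; ring)
  refine ⟨c.backwardFrom t₀, c.forwardFrom t₀, ξ, η, c.endpoint_backwardFrom t₀,
    c.endpoint_forwardFrom t₀, ⟨h2, h1, by rw [symm, h3], fun t => ?_⟩,
    ⟨h1, h2, h3, fun t => hc t⟩, ?_⟩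
  · change (c (t₀ - t)).futureRep = _
    rw [sub_eq_add_neg, hc, neg_neg]; exact add_comm _ _
  · simpa [add_comm] using hc 0

namespace IsNullFrame

variable {x y : GeodesicRay (RealHyperbolicSpace n)} {ξ η ξ' η' : Fin (n + 1) → ℝ}

lemma tendsto_exp_neg : Tendsto (fun t : ℝ≥0 => Real.exp (-(2 * t))) atTop (𝓝 0) :=
  Real.tendsto_exp_neg_atTop_nhds_zero.comp
    ((NNReal.tendsto_coe_atTop.mpr tendsto_id).const_mul_atTop two_pos)

/-- `ξ` is the limit of exp(-t) times future-pointing vectors. -/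
lemma last_nonneg (h : IsNullFrame x ξ η) : 0 ≤ ξ (Fin.last n) := by
  have h1 : Tendsto (fun t : ℝ≥0 => ξ (Fin.last n) + Real.exp (-(2 * t)) * η (Fin.last n)) atTop
      (𝓝 (ξ (Fin.last n) + 0 * η (Fin.last n))) :=
    tendsto_const_nhds.add (tendsto_exp_neg.mul_const _)
  rw [zero_mul, add_zero] at h1
  refine ge_of_tendsto' h1 fun t => ?_
  have h2 := (x t).futureRep_last_pos
  rw [h.futureRep_eq] at h2
  have h3 := mul_pos (Real.exp_pos (-t)) h2
  refine h3.le.trans_eq ?_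
  simp only [Pi.add_apply, Pi.smul_apply, smul_eq_mul, mul_add, ← mul_assoc, ← Real.exp_add]
  congr 2 <;> ring_nf
  simp

/-- A null vector orthogonal to a negative one is zero, which ⟨ξ | η⟩ = -1/2 excludes. -/
lemma form_point_neg (h : IsNullFrame x ξ η) (o : RealHyperbolicSpace n) :
    lorentzForm ξ o.futureRep < 0 := by
  refine lt_of_le_of_ne (nonpos_of_causal h.null_left.le (by rw [futureRep_self]; norm_num)
    h.last_nonneg o.futureRep_last_pos.le) fun h0 => ?_
  have h1 := (orthogonal (by rw [o.futureRep_self]; norm_num) h0).2 h.null_left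
  have h2 := h.form_eq
  rw [h1] at h2
  norm_num [lorentzForm] at h2

lemma form_nonpos (h : IsNullFrame x ξ η) (h' : IsNullFrame y ξ' η') : lorentzForm ξ ξ' ≤ 0 :=
  nonpos_of_causal h.null_left.le h'.null_left.le h.last_nonneg h'.last_nonneg

lemma form_rays (h : IsNullFrame x ξ η) (h' : IsNullFrame y ξ' η') (t : ℝ≥0) :
    lorentzForm (x t).futureRep (y t).futureRep = Real.exp (2 * t) * lorentzForm ξ ξ' +
      lorentzForm ξ η' + lorentzForm η ξ' + Real.exp (-(2 * t)) * lorentzForm η η' := by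
  have e0 : Real.exp t * Real.exp (-t) = 1 := by rw [← Real.exp_add]; simp
  have e1 : Real.exp (2 * t) = Real.exp t * Real.exp t := by rw [← Real.exp_add]; congr 1; ring
  have e2 : Real.exp (-(2 * t)) = Real.exp (-t) * Real.exp (-t) := by
    rw [← Real.exp_add]; congr 1; ring
  rw [h.futureRep_eq, h'.futureRep_eq, e1, e2]
  simp only [add_left, add_right, smul_left, smul_right]
  linear_combination (lorentzForm ξ η' + lorentzForm η ξ') * e0

lemma tendsto_form (h : IsNullFrame x ξ η) (h' : IsNullFrame y ξ' η') :
    Tendsto (fun t : ℝ≥0 => -lorentzForm (x t).futureRep (y t).futureRep * Real.exp (-(2 * t)))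
      atTop (𝓝 (-lorentzForm ξ ξ')) := by
  have e : ∀ t : ℝ≥0, Real.exp (2 * t) * Real.exp (-(2 * t)) = 1 := fun t => by
    rw [← Real.exp_add]; simp
  have h1 : Tendsto (fun t : ℝ≥0 => -lorentzForm ξ ξ' +
      (-(lorentzForm ξ η' + lorentzForm η ξ') * Real.exp (-(2 * t)) +
      -lorentzForm η η' * (Real.exp (-(2 * t)) * Real.exp (-(2 * t))))) atTop
      (𝓝 (-lorentzForm ξ ξ' +
      (-(lorentzForm ξ η' + lorentzForm η ξ') * 0 + -lorentzForm η η' * (0 * 0)))) :=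
    tendsto_const_nhds.add ((tendsto_exp_neg.const_mul _).add
      ((tendsto_exp_neg.mul tendsto_exp_neg).const_mul _))
  simp only [mul_zero, add_zero] at h1
  refine h1.congr fun t => ?_
  rw [h.form_rays h']
  linear_combination lorentzForm ξ ξ' * e t

lemma tendsto_form_point (h : IsNullFrame x ξ η) (o : RealHyperbolicSpace n) :
    Tendsto (fun t : ℝ≥0 => -lorentzForm (x t).futureRep o.futureRep * Real.exp (-(1 * t)))
      atTop (𝓝 (-lorentzForm ξ o.futureRep)) := by
  have h1 : Tendsto (fun t : ℝ≥0 => -lorentzForm ξ o.futureRep +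
      -lorentzForm η o.futureRep * Real.exp (-(2 * t))) atTop
      (𝓝 (-lorentzForm ξ o.futureRep + -lorentzForm η o.futureRep * 0)) :=
    tendsto_const_nhds.add (tendsto_exp_neg.const_mul _)
  simp only [mul_zero, add_zero] at h1
  refine h1.congr fun t => ?_
  have e0 : Real.exp t * Real.exp (-t) = 1 := by rw [← Real.exp_add]; simp
  have e2 : Real.exp (-(2 * t)) = Real.exp (-t) * Real.exp (-t) := by
    rw [← Real.exp_add]; congr 1; ring
  rw [h.futureRep_eq, e2, one_mul, add_left, smul_left, smul_left]
  linear_combination lorentzForm ξ o.futureRep * e0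

/-- The leading term of cosh d(x(t), y(t)) is -⟨ξ | ξ'⟩ exp(2t), and the remaining terms are
bounded. The rays therefore stay close exactly when this coefficient vanishes. -/
lemma endpoint_eq_iff (h : IsNullFrame x ξ η) (h' : IsNullFrame y ξ' η') :
    x.endpoint = y.endpoint ↔ lorentzForm ξ ξ' = 0 := by
  constructor
  · intro he
    obtain ⟨K, -, hK⟩ := GeodesicRay.endpoint_eq_iff.mp he
    have h1 := h.tendsto_form h'
    have h2 : Tendsto (fun t : ℝ≥0 => Real.cosh K * Real.exp (-(2 * t))) atTop
        (𝓝 (Real.cosh K * 0)) := tendsto_exp_neg.const_mul _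
    have h3 := le_of_tendsto_of_tendsto' h1 h2 fun t => by
      refine mul_le_mul_of_nonneg_right ?_ (Real.exp_pos _).le
      rw [lorentzForm_futureRep, neg_neg, Real.cosh_le_cosh, abs_of_nonneg dist_nonneg]
      exact (hK t).le.trans (le_abs_self K)
    have := h.form_nonpos h'
    linarith
  · intro h0
    set M := |lorentzForm ξ η'| + |lorentzForm η ξ'| + |lorentzForm η η'| with hM
    refine GeodesicRay.endpoint_eq_of_dist_le (K := Real.arcosh (M + 1)) fun t => ?_
    have hM0 : 0 ≤ M := by positivity
    have h1 : Real.cosh (dist (x t) (y t)) ≤ M := by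
      have h2 := lorentzForm_futureRep (x t) (y t)
      rw [h.form_rays h', h0, mul_zero, zero_add] at h2
      have h3 : Real.exp (-(2 * t)) ≤ 1 := Real.exp_le_one_iff.mpr (by linarith [t.2])
      have h4 : Real.exp (-(2 * t)) * |lorentzForm η η'| ≤ 1 * |lorentzForm η η'| :=
        mul_le_mul_of_nonneg_right h3 (abs_nonneg _)
      have h5 := mul_le_mul_of_nonneg_left (neg_abs_le (lorentzForm η η'))
        (Real.exp_pos (-(2 * t))).le
      linarith [neg_abs_le (lorentzForm ξ η'), neg_abs_le (lorentzForm η ξ')]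
    rw [← abs_of_nonneg (dist_nonneg (x := x t) (y := y t)),
      ← abs_of_nonneg (Real.arcosh_nonneg (show 1 ≤ M + 1 by linarith)), ← Real.cosh_le_cosh,
      Real.cosh_arcosh (by linarith)]
    linarith

lemma form_neg (h : IsNullFrame x ξ η) (h' : IsNullFrame y ξ' η')
    (hxy : x.endpoint ≠ y.endpoint) : lorentzForm ξ ξ' < 0 :=
  lt_of_le_of_ne (h.form_nonpos h') (mt (h.endpoint_eq_iff h').mpr hxy)

lemma exists_eq_smul (h : IsNullFrame x ξ η) (h' : IsNullFrame y ξ' η')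
    (hxy : x.endpoint = y.endpoint) : ∃ k > (0 : ℝ), ξ' = k • ξ :=
  eq_smul_of_null (u := (x 0).futureRep) (by rw [futureRep_self]; norm_num) h.null_left
    h'.null_left ((h.endpoint_eq_iff h').mp hxy) (h.form_point_neg _) (h'.form_point_neg _)

end IsNullFrame

end RealHyperbolicSpace

/-! ### Asymptotics of arcosh, and Ptolemy's equality for null vectors -/

/-- Write arcosh z = log(z + √(z² - 1)) and move the factor exp(-kt) inside the logarithm: both
summands tend to `L`. -/
lemma Real.tendsto_arcosh_sub {z : ℝ≥0 → ℝ} {k L : ℝ} (hk : 0 < k) (hz : ∀ t, 1 ≤ z t)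
    (h : Tendsto (fun t : ℝ≥0 => z t * Real.exp (-(k * t))) atTop (𝓝 L)) (hL : 0 < L) :
    Tendsto (fun t : ℝ≥0 => Real.arcosh (z t) - k * t) atTop (𝓝 (Real.log (2 * L))) := by
  have h0 : Tendsto (fun t : ℝ≥0 => Real.exp (-(k * t))) atTop (𝓝 0) :=
    Real.tendsto_exp_neg_atTop_nhds_zero.comp
      ((NNReal.tendsto_coe_atTop.mpr tendsto_id).const_mul_atTop hk)
  have h1 := h.add ((h.pow 2).sub (h0.pow 2)).sqrt
  rw [zero_pow two_ne_zero, sub_zero, Real.sqrt_sq hL.le, ← two_mul] at h1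
  refine (h1.log (by positivity)).congr fun t => ?_
  have he := Real.exp_pos (-(k * t))
  rw [show (z t * Real.exp (-(k * t))) ^ 2 - Real.exp (-(k * t)) ^ 2 =
      (z t ^ 2 - 1) * Real.exp (-(k * t)) ^ 2 by ring,
    Real.sqrt_mul (by nlinarith [hz t]), Real.sqrt_sq he.le, ← add_mul,
    ← Real.exp_arcosh (hz t), ← Real.exp_add, Real.log_exp]
  ring

namespace lorentzForm

variable {n : ℕ}

/-- The distance of two null vectors: `bourdonDist` is a rescaling of it. -/
def nullDist (ξ η : Fin (n + 1) → ℝ) : ℝ := √(2 * -lorentzForm ξ η)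

lemma nullDist_comm (ξ η : Fin (n + 1) → ℝ) : nullDist ξ η = nullDist η ξ := by
  rw [nullDist, nullDist, symm]

lemma nullDist_pos {ξ η : Fin (n + 1) → ℝ} (h : lorentzForm ξ η < 0) : 0 < nullDist ξ η :=
  Real.sqrt_pos.mpr (by linarith)

lemma eq_nullDist {ξ η : Fin (n + 1) → ℝ} (h : lorentzForm ξ η ≤ 0) :
    lorentzForm ξ η = -nullDist ξ η ^ 2 / 2 := by
  rw [nullDist, Real.sq_sqrt (by linarith)]; ring

/-- Equality in Ptolemy's inequality forces the planes spanned by the diagonals to meet. -/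
lemma exists_smul_add_eq {a b c d : Fin (n + 1) → ℝ} (ha : lorentzForm a a = 0)
    (hb : lorentzForm b b = 0) (hc : lorentzForm c c = 0) (hd : lorentzForm d d = 0)
    (hab : lorentzForm a b < 0) (hac : lorentzForm a c < 0) (had : lorentzForm a d < 0)
    (hbc : lorentzForm b c < 0) (hbd : lorentzForm b d < 0) (hcd : lorentzForm c d < 0)
    (h : nullDist a d * nullDist b c + nullDist a c * nullDist b d =
      nullDist a b * nullDist c d) :
    ∃ k > (0 : ℝ), ∃ l > (0 : ℝ), ∃ r > (0 : ℝ), ∃ s > (0 : ℝ),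
      k • a + l • b = r • c + s • d := by
  have pab := nullDist_pos hab
  have pac := nullDist_pos hac
  have pad := nullDist_pos had
  have pbc := nullDist_pos hbc
  have pbd := nullDist_pos hbd
  have pcd := nullDist_pos hcd
  have eab := eq_nullDist hab.le
  have eac := eq_nullDist hac.le
  have ead := eq_nullDist had.le
  have ebc := eq_nullDist hbc.le
  have ebd := eq_nullDist hbd.le
  have ecd := eq_nullDist hcd.le
  set ab := nullDist a b
  set ac := nullDist a c
  set ad := nullDist a d
  set bc := nullDist b c
  set bd := nullDist b d
  set cd := nullDist c d
  -- Each weight is the product of the sides of the triangle formed by the other three points. For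
  -- points on a circle this is proportional to the triangle's area, the classical weight in the
  -- affine relation between the vertices of a convex quadrilateral.
  set k := bc * cd * bd with hk
  set l := ac * cd * ad with hl
  set r := ab * bd * ad with hr
  set s := ab * bc * ac with hs
  refine ⟨k, by positivity, l, by positivity, r, by positivity, s, by positivity, ?_⟩
  have hv : lorentzForm (k • a + l • b) (k • a + l • b) = -(k * l * ab ^ 2) := by
    simp only [add_left, add_right, smul_left, smul_right, ha, hb, symm b a, eab]; ring
  -- Ptolemy's equality makes the difference of the two sides null and orthogonal to the negative
  -- vector ka + lb.
  refine sub_eq_zero.mp ((orthogonal (y := k • a + l • b) ?_ ?_).2 ?_)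
  · rw [hv, neg_lt_zero]; positivity
  · rw [sub_left, hv]
    simp only [add_left, add_right, smul_left, smul_right, symm c a, symm c b, symm d a,
      symm d b, eac, ead, ebc, ebd]
    simp only [hk, hl, hr, hs]
    linear_combination (ab * ac * ad * bc * bd * cd) * h
  · simp only [sub_left, sub_right, add_left, add_right, smul_left, smul_right, ha, hb, hc, hd,
      symm b a, symm c a, symm c b, symm d a, symm d b, symm d c, eab, eac, ead, ebc, ebd, ecd]
    simp only [hk, hl, hr, hs]
    linear_combination 2 * (ab * ac * ad * bc * bd * cd) * h

end lorentzForm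

/-! ### Gromov products, cross ratios and intersecting lines in hyperbolic space -/

namespace RealHyperbolicSpace

variable {n : ℕ}

open lorentzForm

namespace IsNullFrame

variable {x y : GeodesicRay (RealHyperbolicSpace n)} {ξ η ξ' η' : Fin (n + 1) → ℝ}

lemma tendsto_dist (h : IsNullFrame x ξ η) (h' : IsNullFrame y ξ' η')
    (hxy : x.endpoint ≠ y.endpoint) :
    Tendsto (fun t : ℝ≥0 => dist (x t) (y t) - 2 * t) atTop
      (𝓝 (Real.log (2 * -lorentzForm ξ ξ'))) := by
  simp only [dist_eq_arcosh_futureRep]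
  refine Real.tendsto_arcosh_sub two_pos (fun t => ?_) (h.tendsto_form h')
    (neg_pos.mpr (h.form_neg h' hxy))
  rw [lorentzForm_futureRep, neg_neg]
  exact Real.one_le_cosh _

lemma tendsto_dist_point (h : IsNullFrame x ξ η) (o : RealHyperbolicSpace n) :
    Tendsto (fun t : ℝ≥0 => dist (x t) o - t) atTop
      (𝓝 (Real.log (2 * -lorentzForm ξ o.futureRep))) := by
  have := Real.tendsto_arcosh_sub one_pos (fun t => ?_) (h.tendsto_form_point o)
    (neg_pos.mpr (h.form_point_neg o))
  · simpa only [dist_eq_arcosh_futureRep, one_mul] using this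
  · rw [lorentzForm_futureRep, neg_neg]
    exact Real.one_le_cosh _

lemma tendsto_gromovProduct (h : IsNullFrame x ξ η) (h' : IsNullFrame y ξ' η')
    (hxy : x.endpoint ≠ y.endpoint) (o : RealHyperbolicSpace n) :
    Tendsto (fun t : ℝ≥0 => gromovProduct o (x t) (y t)) atTop
      (𝓝 ((Real.log (2 * -lorentzForm ξ o.futureRep) + Real.log (2 * -lorentzForm ξ' o.futureRep) -
        Real.log (2 * -lorentzForm ξ ξ')) / 2)) := by
  refine ((((h.tendsto_dist_point o).add (h'.tendsto_dist_point o)).sub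
    (h.tendsto_dist h' hxy)).div_const 2).congr fun t => ?_
  rw [gromovProduct]; ring

end IsNullFrame

theorem gromovProductConverges : GromovProductConverges (RealHyperbolicSpace n) := by
  intro o x y hxy
  obtain ⟨ξ, η, hx⟩ := exists_isNullFrame x
  obtain ⟨ξ', η', hy⟩ := exists_isNullFrame y
  have ex : (Quotient.out x.endpoint : GeodesicRay (RealHyperbolicSpace n)).endpoint = x.endpoint :=
    Quotient.out_eq _
  have ey : (Quotient.out y.endpoint : GeodesicRay (RealHyperbolicSpace n)).endpoint = y.endpoint :=
    Quotient.out_eq _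
  obtain ⟨u, _, hu⟩ := exists_isNullFrame (Quotient.out x.endpoint : GeodesicRay _)
  obtain ⟨v, _, hv⟩ := exists_isNullFrame (Quotient.out y.endpoint : GeodesicRay _)
  -- Other representatives rescale the null vectors by `k` and `l`; the terms log k and log l cancel
  -- in the limit of the Gromov products.
  obtain ⟨k, hk, rfl⟩ := hx.exists_eq_smul hu ex.symm
  obtain ⟨l, hl, rfl⟩ := hy.exists_eq_smul hv ey.symm
  rw [boundaryGromovProduct, (hu.tendsto_gromovProduct hv (by rwa [ex, ey]) o).limUnder_eq]
  convert hx.tendsto_gromovProduct hy hxy o using 2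
  have h1 := neg_pos.mpr (hx.form_point_neg o)
  have h2 := neg_pos.mpr (hy.form_point_neg o)
  have h3 := neg_pos.mpr (hx.form_neg hy hxy)
  rw [smul_left, smul_left, smul_left, smul_right,
    show 2 * -(k * lorentzForm ξ o.futureRep) = k * (2 * -lorentzForm ξ o.futureRep) by ring,
    show 2 * -(l * lorentzForm ξ' o.futureRep) = l * (2 * -lorentzForm ξ' o.futureRep) by ring,
    show 2 * -(k * (l * lorentzForm ξ ξ')) = k * l * (2 * -lorentzForm ξ ξ') by ring,
    Real.log_mul hk.ne' (by positivity), Real.log_mul hl.ne' (by positivity),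
    Real.log_mul (mul_pos hk hl).ne' (by positivity), Real.log_mul hk.ne' hl.ne']
  ring

/-- The limits of d - 2t are 2 log `nullDist`, so halving and exponentiating leaves a ratio of null
distances. -/
lemma crossRatio_eq_nullDist (o : RealHyperbolicSpace n)
    {x y z w : GeodesicRay (RealHyperbolicSpace n)} {a b c d a' b' c' d' : Fin (n + 1) → ℝ}
    (ha : IsNullFrame x a a') (hb : IsNullFrame y b b') (hc : IsNullFrame z c c')
    (hd : IsNullFrame w d d')
    (hxz : x.endpoint ≠ z.endpoint) (hyw : y.endpoint ≠ w.endpoint)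
    (hxw : x.endpoint ≠ w.endpoint) (hyz : y.endpoint ≠ z.endpoint) :
    crossRatio o x.endpoint y.endpoint z.endpoint w.endpoint =
      nullDist a c * nullDist b d / (nullDist a d * nullDist b c) := by
  rw [crossRatio_eq_exp gromovProductConverges o hxz hyw hxw hyz (ha.tendsto_dist hc hxz)
    (hb.tendsto_dist hd hyw) (ha.tendsto_dist hd hxw) (hb.tendsto_dist hc hyz)]
  have key : ∀ {ξ η : Fin (n + 1) → ℝ}, lorentzForm ξ η < 0 →
      Real.log (2 * -lorentzForm ξ η) = 2 * Real.log (nullDist ξ η) := by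
    intro ξ η h
    rw [nullDist, Real.log_sqrt (by linarith)]; ring
  have h1 := ha.form_neg hc hxz
  have h2 := hb.form_neg hd hyw
  have h3 := ha.form_neg hd hxw
  have h4 := hb.form_neg hc hyz
  rw [key h1, key h2, key h3, key h4]
  conv_rhs => rw [← Real.exp_log (nullDist_pos h1), ← Real.exp_log (nullDist_pos h2),
    ← Real.exp_log (nullDist_pos h3), ← Real.exp_log (nullDist_pos h4), ← Real.exp_add,
    ← Real.exp_add, ← Real.exp_sub]
  congr 1; ring

lemma futureRep_injective : Function.Injective (futureRep (n := n)) := by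
  intro p q h
  rw [← dist_eq_zero, dist_eq_arcosh_futureRep, h, futureRep_self]
  simp

/-- The points represented by positive combinations of the null vectors of two rays lie on the
line between their endpoints. -/
lemma mem_lineBetween {x y : GeodesicRay (RealHyperbolicSpace n)} {ξ η ξ' η' : Fin (n + 1) → ℝ}
    (hx : IsNullFrame x ξ η) (hy : IsNullFrame y ξ' η') {k l : ℝ} (hk : 0 < k) (hl : 0 < l)
    {p : RealHyperbolicSpace n} (hp : p.futureRep = k • ξ + l • ξ') :
    p ∈ lineBetween x.endpoint y.endpoint := by
  have hkl : lorentzForm (k • ξ) (l • ξ') = -1 / 2 := by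
    have h := p.futureRep_self
    rw [hp] at h
    simp only [add_left, add_right, smul_left, smul_right, hx.null_left, hy.null_left,
      symm ξ' ξ] at h ⊢
    linarith
  have hlk : lorentzForm (l • ξ') (k • ξ) = -1 / 2 := by rw [symm, hkl]
  have hkk : lorentzForm (k • ξ) (k • ξ) = 0 := by simp [smul_left, smul_right, hx.null_left]
  have hll : lorentzForm (l • ξ') (l • ξ') = 0 := by simp [smul_left, smul_right, hy.null_left]
  have hexp : ∀ s t : ℝ, lorentzForm (Real.exp s • l • ξ' + Real.exp (-s) • k • ξ)
      (Real.exp t • l • ξ' + Real.exp (-t) • k • ξ) = -Real.cosh (s - t) := by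
    intro s t
    generalize k • ξ = u at hkl hlk hkk ⊢
    generalize l • ξ' = v at hkl hlk hll ⊢
    rw [add_left, add_right, add_right, smul_left, smul_left, smul_left, smul_left, smul_right,
      smul_right, smul_right, smul_right, hkl, hlk, hkk, hll, Real.cosh_eq, neg_sub, sub_eq_add_neg,
      sub_eq_add_neg, Real.exp_add, Real.exp_add]
    ring
  have hex : ∀ t : ℝ, ∃ q : RealHyperbolicSpace n,
      q.futureRep = Real.exp t • l • ξ' + Real.exp (-t) • k • ξ := fun t => by
    refine exists_futureRep_eq (by rw [hexp]; simp) ?_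
    have h1 := hx.last_nonneg
    have h2 := hy.last_nonneg
    simp only [Pi.add_apply, Pi.smul_apply, smul_eq_mul]
    positivity
  choose f hf using hex
  let c : GeodesicLine (RealHyperbolicSpace n) := ⟨f, fun s t => by
    rw [dist_eq_arcosh_futureRep, hf, hf, hexp, neg_neg, ← Real.cosh_abs,
      Real.arcosh_cosh (abs_nonneg _)]⟩
  have hb : IsNullFrame c.backward (k • ξ) (l • ξ') := ⟨hkk, hll, hkl, fun t => by
    change (f (-t)).futureRep = _
    rw [hf, neg_neg]; exact add_comm _ _⟩
  have hfw : IsNullFrame c.forward (l • ξ') (k • ξ) := ⟨hll, hkk, hlk, fun t => hf t⟩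
  -- Proportional null vectors are orthogonal, so the ends of `c` are the given endpoints.
  refine ⟨c, (hb.endpoint_eq_iff hx).mpr ?_, (hfw.endpoint_eq_iff hy).mpr ?_, 0,
    futureRep_injective ?_⟩
  · rw [smul_left, hx.null_left, mul_zero]
  · rw [smul_left, hy.null_left, mul_zero]
  · change (f 0).futureRep = _
    rw [hf, hp]
    simp only [Real.exp_zero, neg_zero, one_smul]
    exact add_comm _ _

/-- Once the denominator, the product of the diagonals, is cleared, the equation is Ptolemy's
equality for the four null vectors. -/
theorem inter_nonempty_iff {α β γ δ : VisualBoundary (RealHyperbolicSpace n)} (hαβ : α ≠ β)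
    (hαγ : α ≠ γ) (hαδ : α ≠ δ) (hβγ : β ≠ γ) (hβδ : β ≠ δ) (hγδ : γ ≠ δ)
    (o : RealHyperbolicSpace n) :
    (lineBetween α β ∩ lineBetween γ δ).Nonempty ↔
      crossRatio o α γ δ β + crossRatio o α δ γ β = 1 := by
  constructor
  · rintro ⟨p, hp, hp'⟩
    obtain ⟨x, y, a, b, rfl, rfl, ha, hb, hab⟩ := exists_isNullFrame_of_mem_lineBetween hp
    obtain ⟨z, w, c, d, rfl, rfl, hc, hd, hcd⟩ := exists_isNullFrame_of_mem_lineBetween hp'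
    rw [crossRatio_eq_nullDist o ha hc hd hb hαδ hβγ.symm hαβ hγδ,
      crossRatio_eq_nullDist o ha hd hc hb hαγ hβδ.symm hαβ hγδ.symm]
    -- Pairing this with the four null vectors shows that opposite sides are equal and that the
    -- squares of two adjacent sides add up to 1, the common length of the diagonals; these squares
    -- are the two cross ratios.
    have h : a + b = c + d := hab.symm.trans hcd
    have fa := congrArg (lorentzForm a) h
    have fb := congrArg (lorentzForm b) h
    have fc := congrArg (lorentzForm c) h
    have fd := congrArg (lorentzForm d) h
    simp only [add_right, ha.null_left, hb.null_left, hc.null_left, hd.null_left, ha.form_eq,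
      hb.form_eq, hc.form_eq, hd.form_eq, symm c a, symm c b, symm d a, symm d b] at fa fb fc fd
    have h1 : nullDist c b = nullDist a d := by
      rw [nullDist, nullDist, symm c b]; congr 2; linarith
    have h2 : nullDist d b = nullDist a c := by
      rw [nullDist, nullDist, symm d b]; congr 2; linarith
    have h3 : nullDist a b = 1 := by rw [nullDist, ha.form_eq]; norm_num
    have h5 : nullDist c d = 1 := by rw [nullDist, hc.form_eq]; norm_num
    have h6 := eq_nullDist (ha.form_nonpos hd)
    have h7 := eq_nullDist (ha.form_nonpos hc)
    rw [h1, h2, nullDist_comm d c, h3, h5]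
    linarith
  · obtain ⟨x, rfl⟩ := α.exists_endpoint_eq
    obtain ⟨y, rfl⟩ := β.exists_endpoint_eq
    obtain ⟨z, rfl⟩ := γ.exists_endpoint_eq
    obtain ⟨w, rfl⟩ := δ.exists_endpoint_eq
    obtain ⟨a, a', ha⟩ := exists_isNullFrame x
    obtain ⟨b, b', hb⟩ := exists_isNullFrame y
    obtain ⟨c, c', hc⟩ := exists_isNullFrame z
    obtain ⟨d, d', hd⟩ := exists_isNullFrame w
    rw [crossRatio_eq_nullDist o ha hc hd hb hαδ hβγ.symm hαβ hγδ,
      crossRatio_eq_nullDist o ha hd hc hb hαγ hβδ.symm hαβ hγδ.symm, nullDist_comm d c,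
      ← add_div, nullDist_comm c b, nullDist_comm d b]
    intro h
    have nab := ha.form_neg hb hαβ
    have ncd := hc.form_neg hd hγδ
    have pab := nullDist_pos nab
    have pcd := nullDist_pos ncd
    obtain ⟨k, hk, l, hl, r, hr, s, hs, he⟩ := exists_smul_add_eq ha.null_left hb.null_left
      hc.null_left hd.null_left nab (ha.form_neg hc hαγ) (ha.form_neg hd hαδ)
      (hb.form_neg hc hβγ) (hb.form_neg hd hβδ) ncd ((div_eq_one_iff_eq (by positivity)).mp h)
    -- `N ^ 2` is minus the form on ka + lb, so dividing the common vector by `N` puts it on the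
    -- hyperboloid.
    set N := √(2 * (k * (l * -lorentzForm a b))) with hN
    have hpos : 0 < 2 * (k * (l * -lorentzForm a b)) := by
      have := neg_pos.mpr nab
      positivity
    have hN0 : 0 < N := Real.sqrt_pos.mpr hpos
    have hN2 : N ^ 2 = 2 * (k * (l * -lorentzForm a b)) := Real.sq_sqrt hpos.le
    obtain ⟨p, hp⟩ := exists_futureRep_eq (z := (N⁻¹ * k) • a + (N⁻¹ * l) • b) (by
      simp only [add_left, add_right, smul_left, smul_right, ha.null_left, hb.null_left, symm b a]
      field_simp
      linarith) (by
      have h1 := ha.last_nonneg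
      have h2 := hb.last_nonneg
      simp only [Pi.add_apply, Pi.smul_apply, smul_eq_mul]
      positivity)
    refine ⟨p, mem_lineBetween ha hb (by positivity) (by positivity) hp,
      mem_lineBetween hc hd (k := N⁻¹ * r) (l := N⁻¹ * s) (by positivity) (by positivity) ?_⟩
    rw [hp, mul_smul, mul_smul, mul_smul, mul_smul, ← smul_add, he, smul_add]

end RealHyperbolicSpace

end

theorem mainTheorem4 :
    (∀ n : ℕ, 2 ≤ n →
      GromovProductConverges (RealHyperbolicSpace n) ∧
      ∀ α β γ δ : VisualBoundary (RealHyperbolicSpace n),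
        α ≠ β → α ≠ γ → α ≠ δ → β ≠ γ → β ≠ δ → γ ≠ δ →
        ∀ o : RealHyperbolicSpace n,
          ((lineBetween α β ∩ lineBetween γ δ).Nonempty ↔
            crossRatio o α γ δ β + crossRatio o α δ γ β = 1)) ∧
    (∀ (V : Type*) (G : SimpleGraph V) [G.LocallyFinite] (hG : G.IsTree),
      (∀ v : V, 3 ≤ G.degree v) →
      GromovProductConverges (MetricRealisation G hG.connected) ∧
      ∀ α β γ δ : VisualBoundary (MetricRealisation G hG.connected),
        α ≠ β → α ≠ γ → α ≠ δ → β ≠ γ → β ≠ δ → γ ≠ δ →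
        ∀ o : MetricRealisation G hG.connected,
          ((lineBetween α β ∩ lineBetween γ δ).Nonempty ↔
            max (crossRatio o α γ δ β) (crossRatio o α δ γ β) = 1)) :=
  ⟨fun _ _ => ⟨RealHyperbolicSpace.gromovProductConverges,
    fun _ _ _ _ hαβ hαγ hαδ hβγ hβδ hγδ o =>
      RealHyperbolicSpace.inter_nonempty_iff hαβ hαγ hαδ hβγ hβδ hγδ o⟩,
  fun _ _ _ hG _ =>
    have h4 := MetricRealisation.fourPoint (hG := hG.connected) hG
    ⟨h4.gromovProductConverges, fun _ _ _ _ hαβ hαγ hαδ hβγ hβδ hγδ o =>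
      h4.inter_nonempty_iff (MetricRealisation.joined hG) hαβ hαγ hαδ hβγ hβδ hγδ o⟩⟩
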